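/- For even $n\in\mathbb N$ let $\mathcal G_{n,3}$ denote the uniform probability measure on the set of all simple $3$-regular graphs with vertex set $\{1,\dots,n\}$ (there are such graphs for every even $n\ge 4$), and let $G,H$ be two independent random graphs with law $\mathcal G_{n,3}$. Write $E_G$ for the set of edges of $G$, and, when $H$ is connected, $d_H$ for its shortest-path metric on $\{1,\dots,n\}$. Then there is a universal constant $K\in(0,\infty)$ such that, with probability tending to $1$ as $n\to\infty$ through the even integers, $H$ is connected and for every permutation $\pi\in S_n$, $$\frac1{n^2}\sum_{i=1}^n\sum_{j=1}^n d_H(\pi(i),\pi(j))^2\;\le\; \frac Kn\sum_{\{i,j\}\in E_G} d_H(\pi(i),\pi(j))^2 .$$ Here each edge of $G$ is counted once in the sum on the right. -/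

import Mathlib

open Filter Topology MeasureTheory ProbabilityTheory

open Classical in
/-- The set of all simple `d`-regular graphs on the vertex set `Fin n`. -/
def regularGraphs (n d : ℕ) : Set (SimpleGraph (Fin n)) :=
  {G | G.IsRegularOfDegree d}

/-- The uniform distribution on the simple `d`-regular graphs on the vertex set `Fin n`
(a probability measure as soon as there is such a graph). -/
noncomputable def uniformRegularGraph (n d : ℕ) : Measure (SimpleGraph (Fin n)) :=
  uniformOn (regularGraphs n d)

open Classical in
/-- The sum `∑_{{i,j} ∈ E_G} K i j` of a symmetric function `K` over the edges of `G`, each edge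
being counted once, i.e. half the sum over the ordered pairs of adjacent vertices. -/
noncomputable def edgeSum {n : ℕ} (G : SimpleGraph (Fin n)) (K : Fin n → Fin n → ℝ) : ℝ :=
  (1 / 2) * ∑ i, ∑ j, if G.Adj i j then K i j else 0

/-- `H` is connected (so that its shortest-path metric `d_H` is defined), and for every
permutation `π` of the vertices the average of `d_H(π i, π j)²` over all pairs `(i, j)` is at most
`K` times `1/n` times the sum of the same quantity over the edges `{i, j}` of `G`. -/
def PermutationPoincare (K : ℝ) {n : ℕ} (G H : SimpleGraph (Fin n)) : Prop :=
  H.Connected ∧ ∀ π : Equiv.Perm (Fin n),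
    (1 / (n : ℝ) ^ 2) * ∑ i, ∑ j, (H.dist (π i) (π j) : ℝ) ^ 2 ≤
      K * ((1 / (n : ℝ)) * edgeSum G (fun i j => (H.dist (π i) (π j) : ℝ) ^ 2))

/-! ### Counting graphs by degree sequence: the configuration-model upper bound -/

section Counting

open Classical Finset
open scoped Nat

variable {V : Type*} [Fintype V]

/-! Let n = 2k and take r of order log n. With high probability H is connected of diameter at most C
r, so the left side is at most (C r)^2. It then suffices that for every π at least k/2 of the 3k
edges of G have endpoints whose images are more than r apart. A ball of radius r in a cubic graph
has at most 4^r points, so for fixed H and π at most n·4^r pairs are near. When 4^(10r) ≤ n, the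
chance that G places 5k/2 edges among so few pairs is small enough to beat the n! choices of π
(`card_filter_exists_perm_le`).

For the diameter, vertex sets T of size between 5r and k/M span fewer than 6|T|/5 edges
(`card_filter_exists_dense_subset_le`). Balls therefore grow by a factor 5/4 per step until they
contain more than k/M vertices (`lt_mul_card_graphBall`), and only boundedly many disjoint balls of
that size fit (`dist_le_of_lt_mul_card_graphBall`).

All probabilities are ratios of counts. The configuration model bounds counts from above
(`card_graphsWithDegrees_mul_le`). Splicing a new edge between two existing ones gives a recursion,
hence a matching lower bound up to a polynomial factor (`oddProd_le_cubicCount_mul`). That loss is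
harmless in the two estimates above, but not for disconnectedness, whose bound is only O(1/k). There
the recursion is used directly to compare cubic graphs on 2(k - c) and on 2k vertices
(`sum_split_le`). -/

/-- The neighbours of a vertex, as a finset. -/
noncomputable def nbrs (G : SimpleGraph V) (v : V) : Finset V := univ.filter (G.Adj v)

/-- The edges of a graph, as a finset. -/
noncomputable def edges (G : SimpleGraph V) : Finset (Sym2 V) := G.edgeFinset

/-- The graphs with a given degree sequence. -/
noncomputable def graphsWithDegrees (d : V → ℕ) : Finset (SimpleGraph V) :=
  univ.filter fun G => ∀ v, (nbrs G v).card = d v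

/-- The number of pairs of a set of pairs that contain a given vertex. -/
noncomputable def pairDegree (F : Finset (Sym2 V)) (v : V) : ℕ :=
  (univ.filter fun w => s(v, w) ∈ F).card

/-- The product of the first `m` odd numbers. -/
def oddProd (m : ℕ) : ℕ := ∏ i ∈ range m, (2 * i + 1)

theorem oddProd_succ (m : ℕ) : oddProd (m + 1) = oddProd m * (2 * m + 1) := prod_range_succ _ _

theorem oddProd_pos (m : ℕ) : 0 < oddProd m := prod_pos fun _ _ => by omega

@[simp] theorem mem_nbrs {G : SimpleGraph V} {v w : V} : w ∈ nbrs G v ↔ G.Adj v w := by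
  simp [nbrs]

@[simp] theorem mem_edges {G : SimpleGraph V} {e : Sym2 V} : e ∈ edges G ↔ e ∈ G.edgeSet := by
  simp [edges]

theorem mem_graphsWithDegrees {d : V → ℕ} {G : SimpleGraph V} :
    G ∈ graphsWithDegrees d ↔ ∀ v, (nbrs G v).card = d v := by
  simp [graphsWithDegrees]

theorem sum_card_nbrs (G : SimpleGraph V) : ∑ v, (nbrs G v).card = 2 * (edges G).card := by
  have := G.sum_degrees_eq_twice_card_edges
  rw [edges, ← this]
  refine sum_congr rfl fun v _ => ?_
  rw [← SimpleGraph.card_neighborFinset_eq_degree]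
  congr 1
  ext w
  simp

/-- Deleting `F` is injective on the graphs that contain `F`. -/
theorem card_filter_subset_edges_le (d : V → ℕ) (F : Finset (Sym2 V)) :
    ((graphsWithDegrees d).filter fun G => F ⊆ edges G).card ≤
      (graphsWithDegrees fun v => d v - pairDegree F v).card := by
  refine card_le_card_of_injOn (fun G => G.deleteEdges F) ?_ ?_
  · intro G hG
    simp only [coe_filter, Set.mem_ofPred_eq, mem_graphsWithDegrees] at hG
    simp only [mem_coe, mem_graphsWithDegrees]
    intro v
    rw [← hG.1 v, pairDegree, ← card_sdiff_of_subset]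
    · congr 1
      ext w
      simp
    · intro w hw
      simp only [mem_filter, mem_univ, true_and] at hw
      simpa using hG.2 hw
  · intro G hG G' hG' h
    simp only [coe_filter, Set.mem_ofPred_eq] at hG hG'
    simp only at h
    ext v w
    have h1 : (G.deleteEdges F).Adj v w ↔ (G'.deleteEdges F).Adj v w := by rw [h]
    simp only [SimpleGraph.deleteEdges_adj, mem_coe] at h1
    by_cases hF : s(v, w) ∈ F
    · have a := hG.2 hF
      have b := hG'.2 hF
      simp at a b
      tauto
    · tauto

theorem pairDegree_singleton {v w : V} (h : v ≠ w) (x : V) :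
    pairDegree {s(v, w)} x = (if x = v then 1 else 0) + (if x = w then 1 else 0) := by
  unfold pairDegree
  by_cases hv : x = v
  · subst hv
    simp only [mem_singleton, Sym2.congr_right, h, if_true, if_false]
    exact card_eq_one.2 ⟨w, by ext; simp⟩
  · by_cases hw : x = w
    · subst hw
      simp only [mem_singleton, Sym2.eq_swap (a := v), Sym2.congr_right, hv, if_true, if_false]
      exact card_eq_one.2 ⟨v, by ext; simp⟩
    · simp [hv, hw]

/-- Each simple graph arises from ∏ d(v)! of the (2m - 1)!! pairings of half-edges. The induction
avoids pairings: fix `v` of positive degree, count graphs with a marked neighbour `w` of `v`, and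
delete `vw`. This costs a factor d(v) d(w), and the d(w) with w ≠ v sum to at most 2m + 1. -/
theorem card_graphsWithDegrees_mul_le (m : ℕ) : ∀ d : V → ℕ, ∑ v, d v = 2 * m →
    (graphsWithDegrees d).card * ∏ v, (d v)! ≤ oddProd m := by
  induction m with
  | zero =>
    intro d hd
    have hd0 : ∀ v, d v = 0 := by simpa using hd
    have h1 : (graphsWithDegrees d).card ≤ 1 := by
      rw [card_le_one]
      intro G hG G' hG'
      rw [mem_graphsWithDegrees] at hG hG'
      simp only [hd0, card_eq_zero, Finset.ext_iff, mem_nbrs] at hG hG'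
      ext v w
      have := hG v w
      have := hG' v w
      simp_all
    simpa [hd0, oddProd] using h1
  | succ m ih =>
    intro d hd
    obtain ⟨v, hv⟩ : ∃ v, 0 < d v := by
      by_contra! h
      have : ∑ v, d v = 0 := sum_eq_zero fun v _ => by have := h v; omega
      omega
    have key : ∀ w, ((graphsWithDegrees d).filter fun G => G.Adj v w).card * ∏ x, (d x)! ≤
        (d v * oddProd m) * (if w = v then 0 else d w) := by
      intro w
      rcases ((graphsWithDegrees d).filter fun G => G.Adj v w).eq_empty_or_nonempty with h0 | ⟨G, hG⟩
      · simp [h0]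
      simp only [mem_filter, mem_graphsWithDegrees] at hG
      have hvw : v ≠ w := hG.2.ne
      have hw : 0 < d w := by
        rw [← hG.1 w, card_pos]
        exact ⟨v, by simpa using hG.2.symm⟩
      have hle : ((graphsWithDegrees d).filter fun G => G.Adj v w).card ≤
          (graphsWithDegrees fun x => d x - pairDegree {s(v, w)} x).card := by
        refine le_trans (le_of_eq ?_) (card_filter_subset_edges_le d {s(v, w)})
        congr 1
        ext G
        simp
      have hdx : ∀ x, pairDegree {s(v, w)} x ≤ d x := by
        intro x
        rw [pairDegree_singleton hvw]
        by_cases h1 : x = v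
        · subst h1; simp [hvw]; omega
        · by_cases h2 : x = w
          · subst h2; simp [h1]; omega
          · simp [h1, h2]
      have hsum : ∑ x, (d x - pairDegree {s(v, w)} x) = 2 * m := by
        have h1 : ∑ x, (d x - pairDegree {s(v, w)} x) + ∑ x, pairDegree {s(v, w)} x = ∑ x, d x := by
          rw [← sum_add_distrib]
          exact sum_congr rfl fun x _ => by have := hdx x; omega
        have h2 : ∑ x, pairDegree {s(v, w)} x = 2 := by
          simp [pairDegree_singleton hvw, sum_add_distrib]
        omega
      have hprod : ∏ x, (d x)! = (∏ x, (d x - pairDegree {s(v, w)} x)!) * (d v * d w) := by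
        have h2 : d v * d w = ∏ x, ((if x = v then d x else 1) * (if x = w then d x else 1)) := by
          rw [prod_mul_distrib]
          simp
        rw [h2, ← prod_mul_distrib]
        refine prod_congr rfl fun x _ => ?_
        rw [pairDegree_singleton hvw]
        by_cases h1 : x = v
        · subst h1
          simp [hvw, mul_comm, Nat.mul_factorial_pred hv.ne']
        · by_cases h2 : x = w
          · subst h2; simp [h1, mul_comm, Nat.mul_factorial_pred hw.ne']
          · simp [h1, h2]
      rw [hprod, if_neg hvw.symm, ← mul_assoc]
      calc _ ≤ ((graphsWithDegrees fun x => d x - pairDegree {s(v, w)} x).card *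
              ∏ x, (d x - pairDegree {s(v, w)} x)!) * (d v * d w) := by gcongr
        _ ≤ oddProd m * (d v * d w) := by gcongr; exact ih _ hsum
        _ = _ := by ring
    have hcount : (graphsWithDegrees d).card * d v =
        ∑ w, ((graphsWithDegrees d).filter fun G => G.Adj v w).card := by
      simp only [card_filter]
      rw [sum_comm, ← smul_eq_mul, ← sum_const]
      refine sum_congr rfl fun G hG => ?_
      rw [← (mem_graphsWithDegrees.1 hG) v, nbrs, card_filter]
    have hs : ∑ w, (if w = v then 0 else d w) ≤ 2 * m + 1 := by
      have h1 : ∑ w, (if w = v then 0 else d w) + ∑ w, (if w = v then d w else 0) = ∑ w, d w := by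
        rw [← sum_add_distrib]
        exact sum_congr rfl fun x _ => by split_ifs <;> simp
      simp only [sum_ite_eq', mem_univ, if_true] at h1
      omega
    refine Nat.le_of_mul_le_mul_left ?_ hv
    calc d v * ((graphsWithDegrees d).card * ∏ x, (d x)!)
        = ∑ w, ((graphsWithDegrees d).filter fun G => G.Adj v w).card * ∏ x, (d x)! := by
          rw [← sum_mul, ← hcount]; ring
      _ ≤ ∑ w, (d v * oddProd m) * (if w = v then 0 else d w) := sum_le_sum fun w _ => key w
      _ = (d v * oddProd m) * ∑ w, (if w = v then 0 else d w) := by rw [mul_sum]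
      _ ≤ (d v * oddProd m) * (2 * m + 1) := by gcongr
      _ = d v * oddProd (m + 1) := by rw [oddProd_succ]; ring

/-- The number of graphs that are `3`-regular on `A` and have no edges elsewhere. -/
noncomputable def cubicCount (A : Finset V) : ℕ :=
  (graphsWithDegrees fun v => if v ∈ A then 3 else 0).card

theorem cubicCount_mul_le {A : Finset V} {c : ℕ} (hA : A.card = 2 * c) :
    cubicCount A * 36 ^ c ≤ oddProd (3 * c) := by
  have h := card_graphsWithDegrees_mul_le (3 * c) (fun v => if v ∈ A then 3 else 0) (by simp [hA]; ring)
  have h2 : ∏ v : V, (if v ∈ A then 3 else 0 : ℕ)! = 36 ^ c := by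
    have : ∀ v : V, (if v ∈ A then 3 else 0 : ℕ)! = if v ∈ A then 6 else 1 := by
      intro v; split_ifs <;> rfl
    simp only [this, prod_ite_mem, univ_inter, prod_const, hA, pow_mul]
    norm_num
  rwa [h2] at h

/-- The number of cubic graphs with at least `p` edges in a set `S` of pairs whose members all lie
in `T`. -/
theorem card_cubic_filter_le {k p : ℕ} (hV : Fintype.card V = 2 * k) (S : Finset (Sym2 V))
    (T : Finset V) (hST : ∀ e ∈ S, ∀ v ∈ e, v ∈ T) :
    ((graphsWithDegrees fun _ : V => 3).filter fun G => p ≤ (edges G ∩ S).card).card *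
      6 ^ (2 * k - T.card) ≤ S.card.choose p * oddProd (3 * k - p) := by
  have hsub : ((graphsWithDegrees fun _ : V => 3).filter fun G => p ≤ (edges G ∩ S).card) ⊆
      (S.powersetCard p).biUnion fun F =>
        (graphsWithDegrees fun _ : V => 3).filter fun G => F ⊆ edges G := by
    intro G hG
    simp only [mem_filter] at hG
    obtain ⟨F, hF, hFc⟩ := exists_subset_card_eq hG.2
    simp only [mem_biUnion, mem_powersetCard, mem_filter]
    exact ⟨F, ⟨hF.trans inter_subset_right, hFc⟩, hG.1, hF.trans inter_subset_left⟩
  have hF : ∀ F ∈ S.powersetCard p,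
      ((graphsWithDegrees fun _ : V => 3).filter fun G => F ⊆ edges G).card *
        6 ^ (2 * k - T.card) ≤ oddProd (3 * k - p) := by
    intro F hF
    rw [mem_powersetCard] at hF
    rcases ((graphsWithDegrees fun _ : V => 3).filter
      fun G => F ⊆ edges G).eq_empty_or_nonempty with h0 | ⟨G, hG⟩
    · simp [h0]
    simp only [mem_filter, mem_graphsWithDegrees] at hG
    have hsum : ∑ v, (3 - pairDegree F v) = 2 * (3 * k - p) := by
      have h1 := sum_card_nbrs (G.deleteEdges F)
      have h2 : edges (G.deleteEdges F) = edges G \ F := by ext; simp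
      have h3 := sum_card_nbrs G
      simp only [hG.1, sum_const, smul_eq_mul, card_univ, hV] at h3
      rw [h2, card_sdiff_of_subset hG.2, hF.2] at h1
      rw [show 3 * k - p = (edges G).card - p by omega, ← h1]
      refine sum_congr rfl fun v _ => ?_
      rw [← hG.1 v, pairDegree, ← card_sdiff_of_subset]
      · congr 1
        ext w
        simp
      · intro w hw
        simp only [mem_filter, mem_univ, true_and] at hw
        simpa using hG.2 hw
    have hmain := card_graphsWithDegrees_mul_le (3 * k - p) _ hsum
    refine le_trans ?_ hmain
    refine Nat.mul_le_mul (card_filter_subset_edges_le _ F) ?_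
    -- A vertex outside `T` loses no edge and keeps its factor 3! = 6; inside `T` the factorial is
    -- only bounded below by 1.
    calc 6 ^ (2 * k - T.card) = ∏ v : V, (if v ∈ Tᶜ then 6 else 1) := by
          simp only [prod_ite_mem, univ_inter, prod_const, card_compl, hV]
      _ ≤ _ := by
          refine prod_le_prod' fun v _ => ?_
          split_ifs with h
          · have : pairDegree F v = 0 := by
              rw [pairDegree, card_eq_zero, filter_eq_empty_iff]
              intro w _ hw
              exact (mem_compl.1 h) (hST _ (hF.1 hw) v (by simp))
            rw [this]; decide
          · exact Nat.factorial_pos _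
  calc _ ≤ ((S.powersetCard p).biUnion fun F => (graphsWithDegrees fun _ : V => 3).filter
          fun G => F ⊆ edges G).card * 6 ^ (2 * k - T.card) := by
        gcongr
    _ ≤ (∑ F ∈ S.powersetCard p, ((graphsWithDegrees fun _ : V => 3).filter
          fun G => F ⊆ edges G).card) * 6 ^ (2 * k - T.card) := by
        gcongr; exact card_biUnion_le
    _ ≤ ∑ F ∈ S.powersetCard p, oddProd (3 * k - p) := by
        rw [sum_mul]; exact sum_le_sum hF
    _ = _ := by simp

end Counting

/-! ### Splicing and the lower bound for the number of cubic graphs -/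

section Recursion

open Classical Finset

variable {V : Type*}

theorem cubicCount_le_of_perm [Fintype V] (σ : Equiv.Perm V) {A B : Finset V} (h : ∀ v, σ v ∈ A ↔ v ∈ B) :
    cubicCount A ≤ cubicCount B := by
  refine card_le_card_of_injOn (fun G => G.comap σ) ?_ ?_
  · intro G hG
    simp only [mem_coe, mem_graphsWithDegrees] at hG ⊢
    intro v
    rw [← if_congr (h v) rfl rfl, ← hG (σ v)]
    refine card_bij (fun w _ => σ w) ?_ ?_ ?_
    · simp
    · simp
    · intro w hw
      exact ⟨σ.symm w, by simpa using hw, by simp⟩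
  · intro G _ G' _ hGG
    ext v w
    have h1 : (G.comap σ).Adj (σ.symm v) (σ.symm w) ↔ (G'.comap σ).Adj (σ.symm v) (σ.symm w) := by
      simp only at hGG
      rw [hGG]
    simpa using h1

theorem cubicCount_congr [Fintype V] {A B : Finset V} (h : A.card = B.card) :
    cubicCount A = cubicCount B := by
  have key : ∀ {A B : Finset V}, A.card = B.card → cubicCount A ≤ cubicCount B := by
    intro A B h
    let e : {x // x ∈ B} ≃ {x // x ∈ A} := Fintype.equivOfCardEq (by simpa using h.symm)
    refine cubicCount_le_of_perm e.extendSubtype fun v => ⟨fun hv => ?_, fun hv => ?_⟩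
    · by_contra hvB
      exact e.extendSubtype_not_mem v hvB hv
    · exact e.extendSubtype_mem v hv
  exact le_antisymm (key h) (key h.symm)

/-- Subdivide the edge `e` by `u` and the edge `f` by `v`, and join `u` to `v`. -/
def splice (G : SimpleGraph V) (u v : V) (e f : Sym2 V) : SimpleGraph V :=
  SimpleGraph.fromRel fun x y =>
    (G.Adj x y ∧ s(x, y) ≠ e ∧ s(x, y) ≠ f) ∨ (x = u ∧ (y ∈ e ∨ y = v)) ∨ (x = v ∧ y ∈ f)

section Splice

variable {G : SimpleGraph V} {u v : V} {e f : Sym2 V}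

theorem notMem_of_isolated (hu : ∀ x, ¬ G.Adj u x) (he : e ∈ G.edgeSet) : u ∉ e := by
  rintro ⟨y, rfl⟩
  exact hu y he

theorem splice_adj_of_ne {x : V} (hxu : x ≠ u) (hxv : x ≠ v) (y : V) :
    (splice G u v e f).Adj x y ↔
      (G.Adj x y ∧ s(x, y) ≠ e ∧ s(x, y) ≠ f) ∨ (y = u ∧ x ∈ e) ∨ (y = v ∧ x ∈ f) := by
  simp only [splice, SimpleGraph.fromRel_adj, hxu, hxv, false_and, or_false, G.adj_comm y x,
    Sym2.eq_swap (a := y)]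
  constructor
  · tauto
  · intro h
    refine ⟨?_, by tauto⟩
    rintro rfl
    simp [hxu, hxv] at h

theorem splice_adj_left (huv : u ≠ v) (hu : ∀ x, ¬ G.Adj u x) (he : e ∈ G.edgeSet) (y : V) :
    (splice G u v e f).Adj u y ↔ y ∈ e ∨ y = v := by
  have h1 := notMem_of_isolated hu he
  simp only [splice, SimpleGraph.fromRel_adj, hu, false_and, true_and, G.adj_comm y u, false_or,
    huv, or_false]
  constructor
  · rintro ⟨h, h' | h' | h'⟩
    · exact h'
    · exact absurd h'.1.symm h
    · exact Or.inr h'.1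
  · intro h
    refine ⟨?_, Or.inl h⟩
    rintro rfl
    tauto

theorem splice_adj_right (huv : u ≠ v) (hv : ∀ x, ¬ G.Adj v x) (hf : f ∈ G.edgeSet) (y : V) :
    (splice G u v e f).Adj v y ↔ y ∈ f ∨ y = u := by
  have h1 := notMem_of_isolated hv hf
  simp only [splice, SimpleGraph.fromRel_adj, hv, false_and, true_and, G.adj_comm y v, false_or,
    huv.symm]
  constructor
  · rintro ⟨h, h' | ⟨h', h''⟩ | h'⟩
    · exact Or.inl h'
    · exact Or.inr h'
    · exact absurd h'.1.symm h
  · intro h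
    refine ⟨?_, ?_⟩
    · rintro rfl
      tauto
    · tauto

/-- At `x` the neighbour across `e` is replaced by `u` and the one across `f` by `v`. Since e ≠ f,
both replacements take place even when `e` and `f` meet at `x`. -/
theorem card_nbrs_splice_of_ne [Fintype V] (huv : u ≠ v) (hu : ∀ x, ¬ G.Adj u x) (hv : ∀ x, ¬ G.Adj v x)
    (he : e ∈ G.edgeSet) (hf : f ∈ G.edgeSet) {x : V} (hef : e ≠ f)
    (hxu : x ≠ u) (hxv : x ≠ v) : (nbrs (splice G u v e f) x).card = (nbrs G x).card := by
  have h : nbrs (splice G u v e f) x = (nbrs G x).image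
      fun y => if s(x, y) = e then u else if s(x, y) = f then v else y := by
    ext z
    simp only [mem_nbrs, mem_image, splice_adj_of_ne hxu hxv]
    constructor
    · rintro (⟨h1, h2, h3⟩ | ⟨rfl, y, rfl⟩ | ⟨rfl, y, rfl⟩)
      · exact ⟨z, h1, by simp [h2, h3]⟩
      · exact ⟨y, he, by simp⟩
      · exact ⟨y, hf, by rw [if_neg hef.symm, if_pos rfl]⟩
    · rintro ⟨y, hy, rfl⟩
      split_ifs with h1 h2
      · subst h1; simp
      · subst h2; simp
      · exact Or.inl ⟨hy, h1, h2⟩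
  rw [h]
  refine card_image_of_injOn fun y hy z hz hyz => ?_
  simp only [mem_coe, mem_nbrs] at hy hz
  have hyu : y ≠ u := by rintro rfl; exact hu _ hy.symm
  have hyv : y ≠ v := by rintro rfl; exact hv _ hy.symm
  have hzu : z ≠ u := by rintro rfl; exact hu _ hz.symm
  have hzv : z ≠ v := by rintro rfl; exact hv _ hz.symm
  split_ifs at hyz with h1 h2 h3 h4 h5 h6 h7
  · exact Sym2.congr_right.1 (h1.trans h2.symm)
  · exact absurd hyz huv
  · exact absurd hyz.symm hzu
  · exact absurd hyz.symm huv
  · exact Sym2.congr_right.1 (h4.trans h6.symm)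
  · exact absurd hyz.symm hzv
  · exact absurd hyz hyu
  · exact absurd hyz hyv
  · exact hyz

/-- The counting form of splicing: each graph on `A \ {u, v}` and ordered pair of its edges gives a
graph on `A` with the edge `uv`. -/
theorem cubicCount_mul_le_card_filter_adj [Fintype V] {A B : Finset V} {c : ℕ} (huv : u ≠ v)
    (hu : u ∈ A) (hv : v ∈ A) (hB : B = (A.erase u).erase v) (hc : B.card = 2 * c) :
    cubicCount B * (3 * c * (3 * c - 1)) ≤
      ((graphsWithDegrees fun x => if x ∈ A then 3 else 0).filter fun G => G.Adj u v).card := by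
  have huB : u ∉ B := by simp [hB]
  have hvB : v ∉ B := by simp [hB]
  have hiso : ∀ G ∈ graphsWithDegrees fun x => if x ∈ B then 3 else 0, ∀ x ∉ B, ∀ y, ¬ G.Adj x y := by
    intro G hG x hx y hxy
    have h := (mem_graphsWithDegrees.1 hG) x
    rw [if_neg hx, card_eq_zero] at h
    have : y ∈ nbrs G x := by simpa using hxy
    simp [h] at this
  have hcard : cubicCount B * (3 * c * (3 * c - 1)) =
      ((graphsWithDegrees fun x => if x ∈ B then 3 else 0).sigma
        fun G => (edges G).offDiag).card := by
    rw [card_sigma, cubicCount, ← smul_eq_mul, ← sum_const]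
    refine sum_congr rfl fun G hG => ?_
    have h := sum_card_nbrs G
    simp only [mem_graphsWithDegrees.1 hG, sum_ite_mem, univ_inter, sum_const, hc, smul_eq_mul] at h
    rw [offDiag_card, show (edges G).card = 3 * c by omega, Nat.mul_sub_one]
  rw [hcard]
  refine card_le_card_of_injOn (fun t => splice t.1 u v t.2.1 t.2.2) ?_ ?_
  · rintro ⟨G, e, f⟩ ht
    simp only [mem_coe, mem_sigma, mem_offDiag, mem_edges] at ht
    obtain ⟨hG, he, hf, hef⟩ := ht
    have hGu := hiso G hG u huB
    have hGv := hiso G hG v hvB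
    simp only [coe_filter, Set.mem_ofPred_eq, mem_graphsWithDegrees]
    refine ⟨fun x => ?_, by simp [splice_adj_left huv hGu he]⟩
    by_cases hxu : x = u
    · subst hxu
      rw [if_pos hu]
      have hxe := notMem_of_isolated hGv he
      induction e with | h a b =>
      have hab : a ≠ b := G.ne_of_adj he
      simp only [Sym2.mem_iff, not_or] at hxe
      rw [card_eq_three]
      refine ⟨a, b, v, hab, Ne.symm hxe.1, Ne.symm hxe.2, ?_⟩
      ext y
      simp [splice_adj_left huv hGu he, or_assoc]
    by_cases hxv : x = v
    · subst hxv
      rw [if_pos hv]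
      have hxe := notMem_of_isolated hGu hf
      induction f with | h a b =>
      have hab : a ≠ b := G.ne_of_adj hf
      simp only [Sym2.mem_iff, not_or] at hxe
      rw [card_eq_three]
      refine ⟨a, b, u, hab, Ne.symm hxe.1, Ne.symm hxe.2, ?_⟩
      ext y
      simp [splice_adj_right huv hGv hf, or_assoc]
    rw [card_nbrs_splice_of_ne huv hGu hGv he hf hef hxu hxv, mem_graphsWithDegrees.1 hG x]
    simp [hB, hxu, hxv]
  · rintro ⟨G, e, f⟩ ht ⟨G', e', f'⟩ ht' h
    simp only [mem_coe, mem_sigma, mem_offDiag, mem_edges] at ht ht'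
    obtain ⟨hG, he, hf, hef⟩ := ht
    obtain ⟨hG', he', hf', hef'⟩ := ht'
    have hGu := hiso G hG u huB
    have hGv := hiso G hG v hvB
    have hGu' := hiso G' hG' u huB
    have hGv' := hiso G' hG' v hvB
    simp only at h
    -- Splicing is reversible: `e` is the set of neighbours of `u` other than `v`, `f` that of `v`
    -- other than `u`, and all other adjacencies are those of `G`.
    have hee : e = e' := by
      refine Sym2.ext fun y => ?_
      have h1 := splice_adj_left (f := f) huv hGu he y
      have h2 := splice_adj_left (f := f') huv hGu' he' y
      rw [h, h2] at h1
      by_cases hy : y = v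
      · subst hy
        exact iff_of_false (notMem_of_isolated hGv he) (notMem_of_isolated hGv' he')
      · simpa [hy] using h1.symm
    have hff : f = f' := by
      refine Sym2.ext fun y => ?_
      have h1 := splice_adj_right (e := e) huv hGv hf y
      have h2 := splice_adj_right (e := e') huv hGv' hf' y
      rw [h, h2] at h1
      by_cases hy : y = u
      · subst hy
        exact iff_of_false (notMem_of_isolated hGu hf) (notMem_of_isolated hGu' hf')
      · simpa [hy] using h1.symm
    subst hee hff
    suffices G = G' by rw [this]
    have key : ∀ x y, G.Adj x y ↔ G'.Adj x y := by
      intro x y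
      by_cases hxu : x = u
      · subst hxu
        simp [hGu, hGu']
      by_cases hxv : x = v
      · subst hxv
        simp [hGv, hGv']
      by_cases hyu : y = u
      · subst hyu
        simp [G.adj_comm x, G'.adj_comm x, hGu, hGu']
      by_cases hyv : y = v
      · subst hyv
        simp [G.adj_comm x, G'.adj_comm x, hGv, hGv']
      by_cases h1 : s(x, y) = e
      · subst h1
        exact iff_of_true he he'
      by_cases h2 : s(x, y) = f
      · subst h2
        exact iff_of_true hf hf'
      have h3 := splice_adj_of_ne (G := G) (e := e) (f := f) hxu hxv y
      have h4 := splice_adj_of_ne (G := G') (e := e) (f := f) hxu hxv y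
      rw [h, h4] at h3
      simpa [hyu, hyv, h1, h2] using h3.symm
    ext x y
    exact key x y

end Splice

/-- Fix `u` in `A` and count graphs with a marked neighbour of `u`: three per graph, and at least
3c(3c - 1) spliced graphs per cubic graph on `B` for each of the 2c + 1 possible neighbours. -/
theorem cubicCount_succ_ge [Fintype V] {A B : Finset V} {c : ℕ} (hA : A.card = 2 * c + 2)
    (hB : B.card = 2 * c) :
    cubicCount B * ((2 * c + 1) * c * (3 * c - 1)) ≤ cubicCount A := by
  obtain ⟨u, hu⟩ : A.Nonempty := card_pos.1 (by omega)
  have h1 : cubicCount A * 3 = ∑ v, ((graphsWithDegrees fun x => if x ∈ A then 3 else 0).filter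
      fun G => G.Adj u v).card := by
    simp only [card_filter]
    rw [sum_comm, ← smul_eq_mul, cubicCount, ← sum_const]
    refine sum_congr rfl fun G hG => ?_
    have := (mem_graphsWithDegrees.1 hG) u
    rw [if_pos hu] at this
    rw [← this, nbrs, card_filter]
  have h2 : ∑ v ∈ A.erase u, cubicCount B * (3 * c * (3 * c - 1)) ≤ cubicCount A * 3 := by
    rw [h1]
    refine le_trans (sum_le_sum fun v hv => ?_) (sum_le_univ_sum_of_nonneg fun _ => Nat.zero_le _)
    rw [mem_erase] at hv
    have hc : ((A.erase u).erase v).card = 2 * c := by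
      rw [card_erase_of_mem (by simp [hv]), card_erase_of_mem hu, hA]
      rfl
    rw [cubicCount_congr (hB.trans hc.symm)]
    exact cubicCount_mul_le_card_filter_adj hv.1.symm hu hv.2 rfl hc
  rw [sum_const, card_erase_of_mem hu, hA, smul_eq_mul] at h2
  refine Nat.le_of_mul_le_mul_right ?_ (show 0 < 3 by norm_num)
  refine le_trans (le_of_eq ?_) h2
  rw [show 2 * c + 2 - 1 = 2 * c + 1 by omega]
  ring

/-- One step of the recursion falls short of the growth of (6c - 1)!!/36^c by a factor 1 + O(1/c),
which ((c + 1)/c)^2 absorbs; hence the loss (2c)^2. The base case is the complete graph on four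
vertices. -/
theorem oddProd_le_cubicCount_mul [Fintype V] {c : ℕ} (hc : 2 ≤ c) : ∀ A : Finset V, A.card = 2 * c →
    oddProd (3 * c) ≤ cubicCount A * ((2 * c) ^ 2 * 36 ^ c) := by
  induction c, hc using Nat.le_induction with
  | base =>
    intro A hA
    have h1 : 1 ≤ cubicCount A := by
      refine card_pos.2 ⟨SimpleGraph.fromRel fun x y => x ∈ A ∧ y ∈ A, ?_⟩
      rw [mem_graphsWithDegrees]
      intro v
      split_ifs with h
      · have : nbrs (SimpleGraph.fromRel fun x y => x ∈ A ∧ y ∈ A) v = A.erase v := by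
          ext w
          simp [h, eq_comm]
        rw [this, card_erase_of_mem h, hA]
      · rw [card_eq_zero]
        ext w
        simp [h]
    have h2 : oddProd (3 * 2) = 10395 := by decide
    rw [h2]
    omega
  | succ c hc ih =>
    intro A hA
    obtain ⟨B, hBA, hB⟩ := exists_subset_card_eq (show 2 * c ≤ A.card by omega)
    have h1 := ih B hB
    have h2 := cubicCount_succ_ge (c := c) (by omega) hB
    obtain ⟨b, rfl⟩ : ∃ b, c = b + 1 := ⟨c - 1, by omega⟩
    have h3 : oddProd (3 * (b + 1 + 1)) = oddProd (3 * (b + 1)) *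
        ((6 * (b + 1) + 1) * (6 * (b + 1) + 3) * (6 * (b + 1) + 5)) := by
      rw [show 3 * (b + 1 + 1) = 3 * (b + 1) + 1 + 1 + 1 by ring, oddProd_succ, oddProd_succ,
        oddProd_succ]
      ring
    rw [h3]
    rw [show 3 * (b + 1) - 1 = 3 * b + 2 by omega] at h2
    calc _ ≤ cubicCount B * ((2 * (b + 1)) ^ 2 * 36 ^ (b + 1)) *
          ((6 * (b + 1) + 1) * (6 * (b + 1) + 3) * (6 * (b + 1) + 5)) := by gcongr
      _ ≤ cubicCount B * ((2 * (b + 1) + 1) * (b + 1) * (3 * b + 2)) *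
          ((2 * (b + 1 + 1)) ^ 2 * 36 ^ (b + 1 + 1)) := by
        rw [pow_succ 36 (b + 1)]
        have : (2 * (b + 1)) ^ 2 * ((6 * (b + 1) + 1) * (6 * (b + 1) + 3) * (6 * (b + 1) + 5)) ≤
          ((2 * (b + 1) + 1) * (b + 1) * (3 * b + 2)) * ((2 * (b + 1 + 1)) ^ 2 * 36) := by
          ring_nf
          nlinarith [Nat.zero_le b, Nat.zero_le (b ^ 2), Nat.zero_le (b ^ 3), Nat.zero_le (b ^ 4), Nat.zero_le (b ^ 5)]
        calc _ = cubicCount B * 36 ^ (b + 1) * ((2 * (b + 1)) ^ 2 *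
            ((6 * (b + 1) + 1) * (6 * (b + 1) + 3) * (6 * (b + 1) + 5))) := by ring
          _ ≤ cubicCount B * 36 ^ (b + 1) * (((2 * (b + 1) + 1) * (b + 1) * (3 * b + 2)) *
            ((2 * (b + 1 + 1)) ^ 2 * 36)) := by gcongr
          _ = _ := by ring
      _ ≤ _ := by gcongr

end Recursion

/-! ### Cubic graphs are connected up to a proportion O(1/k) -/

section Disconnected

open Classical Finset

variable {V : Type*} [Fintype V]

/-- The graph formed by the edges of `G` inside `S`. -/
def edgesWithin {V : Type*} (G : SimpleGraph V) (S : Finset V) : SimpleGraph V where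
  Adj x y := G.Adj x y ∧ x ∈ S ∧ y ∈ S
  symm := ⟨fun _ _ h => ⟨h.1.symm, h.2.2, h.2.1⟩⟩
  loopless := ⟨fun _ h => G.irrefl h.1⟩

theorem edgesWithin_mem {G : SimpleGraph V} (hG : G ∈ graphsWithDegrees fun _ : V => 3)
    {S : Finset V} (hS : ∀ x y, G.Adj x y → (x ∈ S ↔ y ∈ S)) :
    edgesWithin G S ∈ graphsWithDegrees fun v => if v ∈ S then 3 else 0 := by
  rw [mem_graphsWithDegrees] at hG ⊢
  intro v
  split_ifs with h
  · rw [← hG v]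
    congr 1
    ext w
    simp only [mem_nbrs, edgesWithin, h, true_and, and_iff_left_iff_imp]
    exact fun hw => (hS v w hw).1 h
  · rw [card_eq_zero]
    ext w
    simp [edgesWithin, h]

/-- Handshake inside `S`: 3|S| is even. -/
theorem even_card_of_closed {G : SimpleGraph V} (hG : G ∈ graphsWithDegrees fun _ : V => 3)
    {S : Finset V} (hS : ∀ x y, G.Adj x y → (x ∈ S ↔ y ∈ S)) : ∃ c, S.card = 2 * c := by
  have h1 := mem_graphsWithDegrees.1 (edgesWithin_mem hG hS)
  have h := sum_card_nbrs (edgesWithin G S)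
  simp only [h1, sum_ite_mem, univ_inter, sum_const, smul_eq_mul] at h
  exact ⟨S.card / 2, by omega⟩

theorem card_filter_closed_le (S : Finset V) :
    ((graphsWithDegrees fun _ : V => 3).filter
      fun G => ∀ x y, G.Adj x y → (x ∈ S ↔ y ∈ S)).card ≤ cubicCount S * cubicCount Sᶜ := by
  rw [cubicCount, cubicCount, ← card_product]
  refine card_le_card_of_injOn (fun G => (edgesWithin G S, edgesWithin G Sᶜ)) ?_ ?_
  · intro G hG
    simp only [coe_filter, Set.mem_ofPred_eq] at hG
    simp only [coe_product, Set.mem_prod, mem_coe]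
    refine ⟨edgesWithin_mem hG.1 hG.2, edgesWithin_mem hG.1 fun x y h => ?_⟩
    simp [hG.2 x y h]
  · intro G hG G' hG' h
    simp only [coe_filter, Set.mem_ofPred_eq] at hG hG'
    simp only [Prod.mk.injEq] at h
    ext x y
    have h1 : (edgesWithin G S).Adj x y ↔ (edgesWithin G' S).Adj x y := by rw [h.1]
    have h2 : (edgesWithin G Sᶜ).Adj x y ↔ (edgesWithin G' Sᶜ).Adj x y := by rw [h.2]
    simp only [edgesWithin, mem_compl] at h1 h2
    have h3 := hG.2 x y
    have h4 := hG'.2 x y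
    by_cases hx : x ∈ S <;> by_cases hy : y ∈ S <;> simp_all

theorem exists_closed_of_not_connected [Nonempty V] {k : ℕ} (hV : Fintype.card V = 2 * k)
    {G : SimpleGraph V} (h : ¬ G.Connected) :
    ∃ S : Finset V, 0 < S.card ∧ S.card ≤ k ∧ ∀ x y, G.Adj x y → (x ∈ S ↔ y ∈ S) := by
  have h' : ∃ u v, ¬ G.Reachable u v := by
    by_contra! h'
    exact h ⟨h'⟩
  obtain ⟨u, v, huv⟩ := h'
  let S : Finset V := univ.filter (G.Reachable u)
  have hS : ∀ x y, G.Adj x y → (x ∈ S ↔ y ∈ S) := by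
    intro x y hxy
    simp only [S, mem_filter, mem_univ, true_and]
    exact ⟨fun h => h.trans hxy.reachable, fun h => h.trans hxy.symm.reachable⟩
  have huS : u ∈ S := by simp [S]
  have hvS : v ∈ Sᶜ := by simp [S, huv]
  have hc := card_add_card_compl S
  rw [hV] at hc
  by_cases hk : S.card ≤ k
  · exact ⟨S, card_pos.2 ⟨u, huS⟩, hk, hS⟩
  · exact ⟨Sᶜ, card_pos.2 ⟨v, hvS⟩, by omega, fun x y h => by simp [hS x y h]⟩

/-- Union bound over the closed set of at most half the vertices, which has even size 2c; a graph is
determined by its restrictions to that set and its complement. -/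
theorem card_not_connected_le_sum [Nonempty V] {k : ℕ} (hV : Fintype.card V = 2 * k) {f : ℕ → ℕ}
    (hf : ∀ (A : Finset V) (c : ℕ), A.card = 2 * c → cubicCount A = f c) :
    ((graphsWithDegrees fun _ : V => 3).filter fun G => ¬ G.Connected).card ≤
      ∑ c ∈ Icc 1 (k / 2), (2 * k).choose (2 * c) * (f c * f (k - c)) := by
  have hsub : ((graphsWithDegrees fun _ : V => 3).filter fun G => ¬ G.Connected) ⊆
      (Icc 1 (k / 2)).biUnion fun c => (powersetCard (2 * c) univ).biUnion fun S =>
        (graphsWithDegrees fun _ : V => 3).filter fun G => ∀ x y, G.Adj x y → (x ∈ S ↔ y ∈ S) := by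
    intro G hG
    rw [mem_filter] at hG
    obtain ⟨S, h0, h1, h2⟩ := exists_closed_of_not_connected hV hG.2
    obtain ⟨c, hc⟩ := even_card_of_closed hG.1 h2
    simp only [mem_biUnion, mem_Icc, mem_powersetCard, mem_filter]
    exact ⟨c, ⟨by omega, by omega⟩, S, ⟨subset_univ S, hc⟩, hG.1, h2⟩
  refine (card_le_card hsub).trans (card_biUnion_le.trans (sum_le_sum fun c hc => ?_))
  refine card_biUnion_le.trans ((sum_le_card_nsmul _ _ (f c * f (k - c)) fun S hS => ?_).trans ?_)
  · rw [mem_powersetCard] at hS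
    have hS' : Sᶜ.card = 2 * (k - c) := by rw [card_compl, hV, hS.2, Nat.mul_sub]
    rw [← hf S c hS.2, ← hf Sᶜ (k - c) hS']
    exact card_filter_closed_le S
  · rw [card_powersetCard, card_univ, hV, smul_eq_mul]

/-- Up to the factor `k - c`, an upper bound for the number of cubic graphs on `2 * k` vertices with
a union of components of `2 * c` vertices. -/
noncomputable def splitWeight (f : ℕ → ℕ) (k c : ℕ) : ℝ :=
  ((k : ℝ) - c) * ((2 * k).choose (2 * c) : ℝ) * (oddProd (3 * c) / 36 ^ c) * f (k - c)

/-- Here j = k - c - 1. The factor k - c in the weight makes the binomial ratio cancel against (2j +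
1)j in the recursion, leaving a ratio of consecutive weights of at most (3c + 1)/(3j - 1). -/
theorem splitWeight_succ_mul_le {f : ℕ → ℕ} {c j : ℕ} (hj : 1 ≤ j)
    (hf : f j * ((2 * j + 1) * j * (3 * j - 1)) ≤ f (j + 1)) :
    splitWeight f (c + j + 1) (c + 1) * (3 * j - 1) ≤
      splitWeight f (c + j + 1) c * (3 * c + 1) := by
  have h1 := Nat.choose_succ_right_eq (2 * (c + j + 1)) (2 * c)
  have h2 := Nat.choose_succ_right_eq (2 * (c + j + 1)) (2 * c + 1)
  rw [show 2 * (c + j + 1) - 2 * c = 2 * j + 2 by omega] at h1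
  rw [show 2 * (c + j + 1) - (2 * c + 1) = 2 * j + 1 by omega] at h2
  have h3 : oddProd (3 * (c + 1)) = oddProd (3 * c) *
      ((6 * c + 1) * (6 * c + 3) * (6 * c + 5)) := by
    rw [show 3 * (c + 1) = 3 * c + 1 + 1 + 1 by ring, oddProd_succ, oddProd_succ, oddProd_succ]
    ring
  have hf' : (f j : ℝ) * ((2 * j + 1) * j * (3 * j - 1)) ≤ f (j + 1) := by
    have : ((3 * j - 1 : ℕ) : ℝ) = 3 * j - 1 := by
      rw [Nat.cast_sub (by omega)]; push_cast; ring
    rw [← this]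
    exact_mod_cast hf
  unfold splitWeight
  rw [show c + j + 1 - (c + 1) = j by omega, show c + j + 1 - c = j + 1 by omega, h3,
    show 2 * (c + 1) = 2 * c + 1 + 1 by ring]
  set a := (2 * (c + j + 1)).choose (2 * c)
  set b := (2 * (c + j + 1)).choose (2 * c + 1)
  set d := (2 * (c + j + 1)).choose (2 * c + 1 + 1)
  have h1' : (b : ℝ) * (2 * c + 1) = a * (2 * j + 2) := by exact_mod_cast h1
  have h2' : (d : ℝ) * (2 * c + 1 + 1) = b * (2 * j + 1) := by exact_mod_cast h2
  have hb : (b : ℝ) = a * (2 * j + 2) / (2 * c + 1) := by field_simp; linarith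
  have hd : (d : ℝ) = a * (2 * j + 2) * (2 * j + 1) / ((2 * c + 1) * (2 * c + 2)) := by
    rw [hb] at h2'
    field_simp at h2' ⊢
    linarith
  rw [hd]
  push_cast
  have hO : (0 : ℝ) ≤ oddProd (3 * c) := by positivity
  calc _ = (a * (oddProd (3 * c) / 36 ^ c) * (j + 1)) * ((6 * c + 1) * (6 * c + 5) / (12 * (c + 1))) *
        ((f j : ℝ) * ((2 * j + 1) * j * (3 * j - 1))) := by
        rw [pow_succ]; field_simp; ring
    _ ≤ (a * (oddProd (3 * c) / 36 ^ c) * (j + 1)) * (3 * c + 1) * f (j + 1) := by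
        refine mul_le_mul ?_ hf' ?_ (by positivity)
        · gcongr
          rw [div_le_iff₀ (by positivity)]
          nlinarith [(Nat.cast_nonneg c : (0 : ℝ) ≤ c)]
        · have : (1 : ℝ) ≤ j := by exact_mod_cast hj
          have : (0 : ℝ) ≤ 3 * j - 1 := by linarith
          positivity
    _ = _ := by ring

theorem splitWeight_nonneg {f : ℕ → ℕ} {k c : ℕ} (h : c ≤ k) : 0 ≤ splitWeight f k c := by
  have : (0 : ℝ) ≤ k - c := by rw [sub_nonneg]; exact_mod_cast h
  unfold splitWeight
  positivity

/-- Write W for the weight and F for f(k). From W(0) = kF the ratio bound gives W(1) ≤ F and W(2) ≤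
4F/k, and W is nonincreasing from 2 to k/2. As k - c ≥ k/2, each summand is at most (2/k)W(c): c = 1
contributes 2F/k, and the other terms, at most k of them, contribute 8F/k in all. -/
theorem sum_split_le {f : ℕ → ℕ} {k : ℕ} (hk : 4 ≤ k)
    (hf : ∀ j, 1 ≤ j → j < k → f j * ((2 * j + 1) * j * (3 * j - 1)) ≤ f (j + 1)) :
    ∑ c ∈ Icc 1 (k / 2), ((2 * k).choose (2 * c) : ℝ) * (oddProd (3 * c) / 36 ^ c) * f (k - c) ≤
      10 / k * f k := by
  have hk' : (4 : ℝ) ≤ k := by exact_mod_cast hk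
  have step : ∀ c, 2 * (c + 1) ≤ k →
      splitWeight f k (c + 1) * (3 * ((k : ℝ) - c) - 4) ≤ splitWeight f k c * (3 * c + 1) := by
    intro c hc
    obtain ⟨j, rfl⟩ : ∃ j, k = c + j + 1 := ⟨k - c - 1, by omega⟩
    have := splitWeight_succ_mul_le (c := c) (show 1 ≤ j by omega) (hf j (by omega) (by omega))
    refine le_trans (le_of_eq ?_) this
    push_cast
    ring
  have h0 : splitWeight f k 0 = k * f k := by simp [splitWeight, oddProd]
  have h1 : splitWeight f k 1 ≤ f k := by
    have := step 0 (by omega)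
    rw [h0] at this
    have hn := splitWeight_nonneg (f := f) (show 1 ≤ k by omega)
    norm_num at this
    nlinarith
  have h2 : splitWeight f k 2 ≤ 4 * f k / k := by
    have := step 1 (by omega)
    have hn := splitWeight_nonneg (f := f) (show 2 ≤ k by omega)
    norm_num at this
    rw [le_div_iff₀ (by linarith)]
    nlinarith
  have h3 : ∀ c, 2 ≤ c → 2 * c ≤ k → splitWeight f k c ≤ 4 * f k / k := by
    intro c hc
    induction c, hc using Nat.le_induction with
    | base => exact fun _ => h2
    | succ c hc ih =>
      intro hck
      refine le_trans ?_ (ih (by omega))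
      have h4 := step c hck
      have h5 : (2 * (c + 1) : ℝ) ≤ k := by exact_mod_cast hck
      have hn := splitWeight_nonneg (f := f) (show c + 1 ≤ k by omega)
      have hn' := splitWeight_nonneg (f := f) (show c ≤ k by omega)
      have hc0 : (0 : ℝ) ≤ c := by positivity
      by_contra! hlt
      nlinarith
  have hterm : ∀ c, 1 ≤ c → 2 * c ≤ k →
      ((2 * k).choose (2 * c) : ℝ) * (oddProd (3 * c) / 36 ^ c) * f (k - c) ≤
        2 / k * splitWeight f k c := by
    intro c _ hck
    have h5 : (2 * c : ℝ) ≤ k := by exact_mod_cast hck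
    unfold splitWeight
    have hX : 0 ≤ ((2 * k).choose (2 * c) : ℝ) * (oddProd (3 * c) / 36 ^ c) * f (k - c) := by
      positivity
    have : (1 : ℝ) ≤ 2 / k * (k - c) := by
      rw [div_mul_eq_mul_div, le_div_iff₀ (by linarith)]
      linarith
    nlinarith
  have hsplit : Icc 1 (k / 2) = insert 1 (Icc 2 (k / 2)) := by
    ext c
    simp only [mem_Icc, mem_insert]
    omega
  rw [hsplit, sum_insert (by simp)]
  have hrest : ∑ c ∈ Icc 2 (k / 2),
      ((2 * k).choose (2 * c) : ℝ) * (oddProd (3 * c) / 36 ^ c) * f (k - c) ≤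
        k * (2 / k * (4 * f k / k)) := by
    refine le_trans (sum_le_card_nsmul _ _ (2 / (k : ℝ) * (4 * f k / k)) fun c hc => ?_) ?_
    · rw [mem_Icc] at hc
      refine (hterm c (by omega) (by omega)).trans ?_
      gcongr
      exact h3 c hc.1 (by omega)
    · rw [nsmul_eq_mul]
      gcongr
      rw [Nat.card_Icc]
      omega
  have hfirst := (hterm 1 le_rfl (by omega)).trans
    (mul_le_mul_of_nonneg_left h1 (show (0 : ℝ) ≤ 2 / k by positivity))
  calc _ ≤ 2 / (k : ℝ) * f k + k * (2 / k * (4 * f k / k)) := add_le_add hfirst hrest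
    _ = _ := by field_simp; ring

theorem cubicCount_univ : cubicCount (univ : Finset V) = (graphsWithDegrees fun _ : V => 3).card := by
  simp [cubicCount]

theorem card_not_connected_le {k : ℕ} (hk : 4 ≤ k) (hV : Fintype.card V = 2 * k) :
    (((graphsWithDegrees fun _ : V => 3).filter fun G => ¬ G.Connected).card : ℝ) ≤
      10 / k * (graphsWithDegrees fun _ : V => 3).card := by
  have : Nonempty V := Fintype.card_pos_iff.1 (by omega)
  have hex : ∀ c, c ≤ k → ∃ A : Finset V, A.card = 2 * c := by
    intro c hc
    obtain ⟨A, -, hA⟩ := exists_subset_card_eq (s := (univ : Finset V)) (n := 2 * c)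
      (by rw [card_univ, hV]; omega)
    exact ⟨A, hA⟩
  obtain ⟨f, hf⟩ : ∃ f : ℕ → ℕ, ∀ (A : Finset V) (c : ℕ), A.card = 2 * c → cubicCount A = f c := by
    refine ⟨fun c => if h : ∃ A : Finset V, A.card = 2 * c then cubicCount h.choose else 0, ?_⟩
    intro A c hA
    have h : ∃ A : Finset V, A.card = 2 * c := ⟨A, hA⟩
    simp only [dif_pos h]
    exact cubicCount_congr (hA.trans h.choose_spec.symm)
  have h1 := card_not_connected_le_sum hV hf
  have h2 := sum_split_le hk (f := f) fun j hj hjk => by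
    obtain ⟨A, hA⟩ := hex (j + 1) (by omega)
    obtain ⟨B, hB⟩ := hex j (by omega)
    rw [← hf A (j + 1) hA, ← hf B j hB]
    exact cubicCount_succ_ge (by omega) hB
  rw [← cubicCount_univ, hf univ k (by rw [card_univ, hV])]
  refine le_trans ?_ h2
  refine le_trans (Nat.cast_le.2 h1) ?_
  push_cast
  refine sum_le_sum fun c hc => ?_
  rw [mem_Icc] at hc
  obtain ⟨A, hA⟩ := hex c (by omega)
  have h3 := cubicCount_mul_le hA
  rw [hf A c hA] at h3
  -- Only the small side is replaced by its configuration-model bound; `f (k - c)` stays exact, so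
  -- no polynomial factor is lost.
  have h4 : (f c : ℝ) ≤ oddProd (3 * c) / 36 ^ c := by
    rw [le_div_iff₀ (by positivity)]
    exact_mod_cast h3
  rw [← mul_assoc]
  gcongr

end Disconnected

/-! ### First-moment estimates for dense subsets and for permutations -/

section Estimates

open Classical Finset
open scoped Nat

variable {V : Type*} [Fintype V]

theorem oddProd_mul_pow_le (a p : ℕ) : oddProd a * (2 * a + 1) ^ p ≤ oddProd (a + p) := by
  induction p with
  | zero => simp
  | succ p ih =>
    rw [← add_assoc, oddProd_succ, pow_succ, ← mul_assoc]
    exact Nat.mul_le_mul ih (by omega)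

/-- Upper count divided by lower count. Prescribing `p` edges removes the top `p` factors of (6k -
1)!!, each at least `k` by `hpk`. -/
theorem card_cubic_filter_mul_pow_le {k p : ℕ} (hk : 2 ≤ k) (hV : Fintype.card V = 2 * k)
    (hp : p ≤ 3 * k) (hpk : k ≤ 2 * (3 * k - p) + 1) (S : Finset (Sym2 V))
    (T : Finset V) (hST : ∀ e ∈ S, ∀ v ∈ e, v ∈ T) :
    ((graphsWithDegrees fun _ : V => 3).filter fun G => p ≤ (edges G ∩ S).card).card * k ^ p ≤
      S.card.choose p * ((2 * k) ^ 2 * 6 ^ T.card) * (graphsWithDegrees fun _ : V => 3).card := by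
  have h1 := card_cubic_filter_le (p := p) hV S T hST
  have h2 := oddProd_le_cubicCount_mul hk (univ : Finset V) (by rw [card_univ, hV])
  rw [cubicCount_univ] at h2
  have h3 := oddProd_mul_pow_le (3 * k - p) p
  rw [Nat.sub_add_cancel hp] at h3
  have hT : T.card ≤ 2 * k := hV ▸ card_le_univ T
  have h36 : 36 ^ k = 6 ^ (2 * k - T.card) * 6 ^ T.card := by
    rw [← pow_add, Nat.sub_add_cancel hT, pow_mul]
    norm_num
  refine Nat.le_of_mul_le_mul_right ?_ (pow_pos (show 0 < 6 by norm_num) (2 * k - T.card))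
  calc _ = (((graphsWithDegrees fun _ : V => 3).filter fun G => p ≤ (edges G ∩ S).card).card *
        6 ^ (2 * k - T.card)) * k ^ p := by ring
    _ ≤ (S.card.choose p * oddProd (3 * k - p)) * (2 * (3 * k - p) + 1) ^ p := by gcongr
    _ = S.card.choose p * (oddProd (3 * k - p) * (2 * (3 * k - p) + 1) ^ p) := by ring
    _ ≤ S.card.choose p * ((graphsWithDegrees fun _ : V => 3).card * ((2 * k) ^ 2 * 36 ^ k)) := by
        exact Nat.mul_le_mul_left _ (h3.trans h2)
    _ = _ := by rw [h36]; ring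

theorem pow_le_three_pow_mul_factorial (n : ℕ) : (n : ℝ) ^ n ≤ 3 ^ n * n ! := by
  have h := Real.pow_div_factorial_le_exp n (Nat.cast_nonneg n) n
  rw [div_le_iff₀ (by positivity)] at h
  refine h.trans ?_
  gcongr
  rw [← Real.exp_one_pow]
  gcongr
  exact Real.exp_one_lt_d9.le.trans (by norm_num)

theorem choose_mul_pow_le (N p : ℕ) : (N.choose p : ℝ) * (p : ℝ) ^ p ≤ (3 * N : ℝ) ^ p := by
  have h1 : (N.choose p : ℝ) ≤ (N : ℝ) ^ p / p ! := Nat.choose_le_pow_div p N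
  rw [le_div_iff₀ (by positivity)] at h1
  calc (N.choose p : ℝ) * (p : ℝ) ^ p ≤ N.choose p * (3 ^ p * p !) := by
        gcongr; exact pow_le_three_pow_mul_factorial p
    _ = 3 ^ p * (N.choose p * p !) := by ring
    _ ≤ 3 ^ p * (N : ℝ) ^ p := by gcongr
    _ = _ := by rw [mul_pow]

/-- Union bound over `T`. The first t of the t + q edges cancel the number of choices of `T` up to
108^t, where 108 = 6 · 3 · 6; the q excess edges supply the small factor (3t/k)^q. -/
theorem card_filter_dense_subset_le {k t : ℕ} (hk : 2 ≤ k) (hV : Fintype.card V = 2 * k)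
    (ht : 0 < t) (htk : 2 * t ≤ k) :
    (((graphsWithDegrees fun _ : V => 3).filter fun G =>
        ∃ T : Finset V, T.card = t ∧ 6 * t ≤ 5 * (edges G ∩ T.sym2).card).card : ℝ) ≤
      4 * (k : ℝ) ^ 2 * (108 ^ 5 * (3 * t / k)) ^ ((t + 4) / 5) *
        (graphsWithDegrees fun _ : V => 3).card := by
  -- This is ⌈t/5⌉, so spanning at least 6t/5 edges means at least t + q.
  set q := (t + 4) / 5 with hq
  set R := graphsWithDegrees fun _ : V => 3
  have hsub : (R.filter fun G => ∃ T : Finset V, T.card = t ∧ 6 * t ≤ 5 * (edges G ∩ T.sym2).card) ⊆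
      (powersetCard t univ).biUnion fun T =>
        R.filter fun G => t + q ≤ (edges G ∩ T.sym2).card := by
    intro G hG
    rw [mem_filter] at hG
    obtain ⟨hG, T, hT, h⟩ := hG
    simp only [mem_biUnion, mem_powersetCard, mem_filter]
    exact ⟨T, ⟨subset_univ T, hT⟩, hG, by omega⟩
  have hT : ∀ T ∈ powersetCard t (univ : Finset V),
      ((R.filter fun G => t + q ≤ (edges G ∩ T.sym2).card).card : ℝ) ≤
        (3 * t / k) ^ (t + q) * ((2 * k) ^ 2 * 6 ^ t) * R.card := by
    intro T hT
    rw [mem_powersetCard] at hT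
    have h1 := card_cubic_filter_mul_pow_le (p := t + q) hk hV (by omega) (by omega) T.sym2 T
      fun e he v hv => mem_sym2_iff.1 he v hv
    rw [hT.2, card_sym2, hT.2] at h1
    have h2 : ((t + 1).choose 2 : ℝ) ≤ t * t := by
      have : (t + 1).choose 2 ≤ t * t := by
        rw [Nat.choose_two_right, Nat.add_sub_cancel]
        refine Nat.div_le_of_le_mul ?_
        nlinarith
      exact_mod_cast this
    have h3 := choose_mul_pow_le ((t + 1).choose 2) (t + q)
    have ht' : (0 : ℝ) < t := by exact_mod_cast ht
    have hk' : (0 : ℝ) < k := by positivity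
    have h4 : (((t + 1).choose 2).choose (t + q) : ℝ) ≤ (3 * t) ^ (t + q) := by
      refine le_of_mul_le_mul_right ?_ (pow_pos ht' (t + q))
      calc _ ≤ (((t + 1).choose 2).choose (t + q) : ℝ) * ((t + q : ℕ) : ℝ) ^ (t + q) := by
            gcongr
            omega
        _ ≤ _ := h3
        _ ≤ (3 * (t * t)) ^ (t + q) := by gcongr
        _ = _ := by rw [← mul_pow]; ring
    have h5 : ((R.filter fun G => t + q ≤ (edges G ∩ T.sym2).card).card : ℝ) * (k : ℝ) ^ (t + q) ≤
        (((t + 1).choose 2).choose (t + q) : ℝ) * ((2 * k) ^ 2 * 6 ^ t) * R.card := by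
      exact_mod_cast h1
    rw [div_pow, div_mul_eq_mul_div, div_mul_eq_mul_div, le_div_iff₀ (by positivity)]
    refine h5.trans ?_
    gcongr
  have hk' : (0 : ℝ) < k := by positivity
  have ht' : (0 : ℝ) < t := by exact_mod_cast ht
  have hchoose : ((2 * k).choose t : ℝ) ≤ (6 * k / t) ^ t := by
    rw [div_pow, le_div_iff₀ (by positivity)]
    refine (choose_mul_pow_le (2 * k) t).trans (le_of_eq ?_)
    push_cast
    ring
  calc _ ≤ ((∑ T ∈ powersetCard t univ,
          (R.filter fun G => t + q ≤ (edges G ∩ T.sym2).card).card : ℕ) : ℝ) := by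
        exact_mod_cast (card_le_card hsub).trans card_biUnion_le
    _ ≤ ((2 * k).choose t : ℝ) * ((3 * t / k) ^ (t + q) * ((2 * k) ^ 2 * 6 ^ t) * R.card) := by
        push_cast
        refine (sum_le_card_nsmul _ _ _ hT).trans (le_of_eq ?_)
        rw [card_powersetCard, card_univ, hV, nsmul_eq_mul]
    _ ≤ (6 * k / t) ^ t * ((3 * t / k) ^ (t + q) * ((2 * k) ^ 2 * 6 ^ t) * R.card) := by gcongr
    _ = 4 * (k : ℝ) ^ 2 * (((6 * k / t) * (3 * t / k) * 6) ^ t * (3 * t / k) ^ q) * R.card := by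
        rw [mul_pow (6 * (k : ℝ) / t * (3 * t / k)), mul_pow (6 * (k : ℝ) / t), pow_add]; ring
    _ = 4 * (k : ℝ) ^ 2 * (108 ^ t * (3 * t / k) ^ q) * R.card := by
        congr 4
        field_simp
        norm_num
    _ ≤ 4 * (k : ℝ) ^ 2 * (108 ^ (5 * q) * (3 * t / k) ^ q) * R.card := by
        gcongr
        · norm_num
        · omega
    _ = _ := by rw [pow_mul, ← mul_pow]

/-- For t ≥ 5r the exponent is at least `r`, and `hM` makes the base at most 1/Z, so each size costs
at most 4k²/Z^r ≤ 1/k²; there are at most `k` sizes. -/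
theorem card_filter_exists_dense_subset_le {k r M Z : ℕ} (hk : 2 ≤ k) (hV : Fintype.card V = 2 * k)
    (hr : 1 ≤ r) (hZ : 4 * k ^ 4 ≤ Z ^ r) (hZ1 : 1 ≤ Z) (hM : 108 ^ 5 * 3 * Z ≤ M) :
    (((graphsWithDegrees fun _ : V => 3).filter fun G => ∃ T : Finset V, 5 * r ≤ T.card ∧
        M * T.card ≤ k ∧ 6 * T.card ≤ 5 * (edges G ∩ T.sym2).card).card : ℝ) ≤
      1 / k * (graphsWithDegrees fun _ : V => 3).card := by
  set R := graphsWithDegrees fun _ : V => 3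
  have hk' : (0 : ℝ) < k := by positivity
  have hsub : (R.filter fun G => ∃ T : Finset V, 5 * r ≤ T.card ∧
        M * T.card ≤ k ∧ 6 * T.card ≤ 5 * (edges G ∩ T.sym2).card) ⊆
      ((Icc 1 k).filter fun t => 5 * r ≤ t ∧ M * t ≤ k).biUnion fun t => R.filter fun G =>
        ∃ T : Finset V, T.card = t ∧ 6 * t ≤ 5 * (edges G ∩ T.sym2).card := by
    intro G hG
    rw [mem_filter] at hG
    obtain ⟨hG, T, h1, h2, h3⟩ := hG
    simp only [mem_biUnion, mem_filter, mem_Icc]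
    refine ⟨T.card, ⟨⟨by omega, ?_⟩, h1, h2⟩, hG, T, rfl, h3⟩
    nlinarith
  have hterm : ∀ t ∈ (Icc 1 k).filter fun t => 5 * r ≤ t ∧ M * t ≤ k,
      ((R.filter fun G => ∃ T : Finset V, T.card = t ∧
        6 * t ≤ 5 * (edges G ∩ T.sym2).card).card : ℝ) ≤ 1 / k ^ 2 * R.card := by
    intro t ht
    simp only [mem_filter, mem_Icc] at ht
    obtain ⟨⟨h1, -⟩, h2, h3⟩ := ht
    refine (card_filter_dense_subset_le hk hV h1 (by nlinarith)).trans ?_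
    gcongr
    have hZ' : (1 : ℝ) ≤ Z := by exact_mod_cast hZ1
    have hb : (108 ^ 5 * (3 * t / k) : ℝ) ≤ 1 / Z := by
      rw [le_div_iff₀ (by positivity), ← mul_div_assoc, div_mul_eq_mul_div, div_le_iff₀ hk', one_mul]
      have : 108 ^ 5 * (3 * t) * Z ≤ k := by nlinarith
      exact_mod_cast this
    calc 4 * (k : ℝ) ^ 2 * (108 ^ 5 * (3 * t / k)) ^ ((t + 4) / 5)
        ≤ 4 * (k : ℝ) ^ 2 * (1 / Z) ^ ((t + 4) / 5) := by gcongr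
      _ ≤ 4 * (k : ℝ) ^ 2 * (1 / Z) ^ r := by
          refine mul_le_mul_of_nonneg_left ?_ (by positivity)
          refine pow_le_pow_of_le_one (by positivity) ?_ (by omega)
          rw [div_le_one (by positivity)]
          exact hZ'
      _ ≤ 1 / (k : ℝ) ^ 2 := by
          have : (4 * (k : ℝ) ^ 4) ≤ Z ^ r := by exact_mod_cast hZ
          rw [div_pow, one_pow, mul_one_div, div_le_div_iff₀ (by positivity) (by positivity)]
          linarith
  calc _ ≤ ((∑ t ∈ (Icc 1 k).filter fun t => 5 * r ≤ t ∧ M * t ≤ k, (R.filter fun G =>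
        ∃ T : Finset V, T.card = t ∧ 6 * t ≤ 5 * (edges G ∩ T.sym2).card).card : ℕ) : ℝ) := by
        exact_mod_cast (card_le_card hsub).trans card_biUnion_le
    _ ≤ k * (1 / k ^ 2 * R.card) := by
        push_cast
        refine (sum_le_card_nsmul _ _ _ hterm).trans ?_
        rw [nsmul_eq_mul]
        gcongr
        refine (card_le_card (filter_subset _ _)).trans ?_
        simp
    _ = _ := by field_simp

theorem thirtytwo_mul_cube_le_two_pow {q : ℕ} (hq : 20 ≤ q) : 32 * q ^ 3 ≤ 2 ^ q := by
  induction q, hq using Nat.le_induction with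
  | base => norm_num
  | succ q hq ih =>
    rw [pow_succ 2]
    nlinarith [Nat.pow_le_pow_left hq 2]

/-- With p = ⌈5k/2⌉ = 2k + q, the first 2k edges offset (2k)! ≤ (2k)^(2k) up to (1296·16^r)^k; the
remaining q ≥ k/2 edges give (3·4^r/k)^q, which wins because 4^r is at most (2k)^(1/10). -/
theorem card_filter_exists_perm_le {k r : ℕ} (hV : Fintype.card V = 2 * k)
    (hr : 4 ^ (10 * r) ≤ 2 * k) (hk : 8 * (1296 ^ 2 * 3) ^ 2 ≤ k)
    (S : Equiv.Perm V → Finset (Sym2 V)) (hS : ∀ π, (S π).card ≤ 2 * k * 4 ^ r) :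
    (((graphsWithDegrees fun _ : V => 3).filter fun G =>
        ∃ π, (5 * k + 1) / 2 ≤ (edges G ∩ S π).card).card : ℝ) ≤
      1 / k * (graphsWithDegrees fun _ : V => 3).card := by
  obtain ⟨q, hq⟩ : ∃ q, (5 * k + 1) / 2 = 2 * k + q := ⟨(5 * k + 1) / 2 - 2 * k, by omega⟩
  rw [hq]
  set R := graphsWithDegrees fun _ : V => 3
  have hk0 : 2 ≤ k := by omega
  have hk' : (0 : ℝ) < k := by positivity
  set y : ℝ := 3 * 4 ^ r / k with hy
  have hy0 : 0 ≤ y := by positivity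
  have hπ : ∀ π ∈ (univ : Finset (Equiv.Perm V)),
      ((R.filter fun G => 2 * k + q ≤ (edges G ∩ S π).card).card : ℝ) ≤
        y ^ (2 * k + q) * ((2 * k) ^ 2 * 6 ^ (2 * k)) * R.card := by
    intro π _
    have h1 := card_cubic_filter_mul_pow_le (p := 2 * k + q) hk0 hV (by omega) (by omega) (S π)
      univ (by simp)
    rw [card_univ, hV] at h1
    have h5 : ((R.filter fun G => 2 * k + q ≤ (edges G ∩ S π).card).card : ℝ) *
        (k : ℝ) ^ (2 * k + q) ≤
        ((S π).card.choose (2 * k + q) : ℝ) * ((2 * k) ^ 2 * 6 ^ (2 * k)) * R.card := by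
      exact_mod_cast h1
    have h3 := choose_mul_pow_le (S π).card (2 * k + q)
    have h4 : ((S π).card.choose (2 * k + q) : ℝ) ≤ (3 * 4 ^ r) ^ (2 * k + q) := by
      refine le_of_mul_le_mul_right ?_ (pow_pos (show (0 : ℝ) < 2 * k by positivity) (2 * k + q))
      calc _ ≤ ((S π).card.choose (2 * k + q) : ℝ) * ((2 * k + q : ℕ) : ℝ) ^ (2 * k + q) := by
            gcongr
            push_cast
            linarith [(Nat.cast_nonneg q : (0 : ℝ) ≤ q)]
        _ ≤ _ := h3
        _ ≤ (3 * (2 * k * 4 ^ r)) ^ (2 * k + q) := by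
            gcongr
            exact_mod_cast hS π
        _ = _ := by rw [← mul_pow]; ring
    rw [hy, div_pow, div_mul_eq_mul_div, div_mul_eq_mul_div, le_div_iff₀ (by positivity)]
    refine h5.trans ?_
    gcongr
  have hsub : (R.filter fun G => ∃ π, 2 * k + q ≤ (edges G ∩ S π).card) ⊆
      univ.biUnion fun π => R.filter fun G => 2 * k + q ≤ (edges G ∩ S π).card := by
    intro G hG
    simpa using hG
  have hfact : ((2 * k)! : ℝ) ≤ (2 * k) ^ (2 * k) := by exact_mod_cast Nat.factorial_le_pow (2 * k)
  -- The left side is 1296²·3·4^(5r)/k with 4^(5r) ≤ √(2k); the bound `hk` on `k` is exactly what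
  -- this needs.
  have hbase : (1296 * 16 ^ r : ℝ) ^ 2 * y ≤ 1 / 2 := by
    have h1 : ((4 : ℝ) ^ (5 * r)) ^ 2 ≤ 2 * k := by
      rw [← pow_mul, show 5 * r * 2 = 10 * r by ring]
      exact_mod_cast hr
    have h2 : (1296 * 16 ^ r : ℝ) ^ 2 * y = 1296 ^ 2 * 3 * 4 ^ (5 * r) / k := by
      rw [hy, show (16 : ℝ) = 4 ^ 2 by norm_num, pow_mul, mul_pow, ← pow_mul, ← pow_mul]
      rw [show (4 ^ 5 : ℝ) ^ r = 4 ^ (2 * r * 2) * 4 ^ r by rw [← pow_mul, ← pow_add]; ring_nf]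
      ring
    have hk2 : (8 * (1296 ^ 2 * 3) ^ 2 : ℝ) ≤ k := by exact_mod_cast hk
    rw [h2, div_le_div_iff₀ hk' (by norm_num)]
    refine le_of_sq_le_sq ?_ (by positivity)
    nlinarith
  have hkq : (k : ℝ) ≤ 2 * q := by
    have : k ≤ 2 * q := by omega
    exact_mod_cast this
  calc _ ≤ ((∑ π, (R.filter fun G => 2 * k + q ≤ (edges G ∩ S π).card).card : ℕ) : ℝ) := by
        exact_mod_cast (card_le_card hsub).trans card_biUnion_le
    _ ≤ ((2 * k)! : ℝ) * (y ^ (2 * k + q) * ((2 * k) ^ 2 * 6 ^ (2 * k)) * R.card) := by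
        push_cast
        refine (sum_le_card_nsmul _ _ _ hπ).trans (le_of_eq ?_)
        rw [card_univ, Fintype.card_perm, hV, nsmul_eq_mul]
    _ ≤ (2 * k) ^ (2 * k) * (y ^ (2 * k + q) * ((2 * k) ^ 2 * 6 ^ (2 * k)) * R.card) := by gcongr
    _ = 4 * (k : ℝ) ^ 2 * (((6 * (2 * k) * y) ^ 2) ^ k * y ^ q) * R.card := by
        rw [← pow_mul, mul_pow (6 * (2 * (k : ℝ))), mul_pow 6 (2 * (k : ℝ)), pow_add]; ring
    _ = 4 * (k : ℝ) ^ 2 * ((1296 * 16 ^ r) ^ k * y ^ q) * R.card := by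
        congr 4
        rw [hy, show (16 : ℝ) = 4 ^ 2 by norm_num, ← pow_mul, mul_comm 2 r, pow_mul]
        field_simp
        norm_num
    _ ≤ 4 * (k : ℝ) ^ 2 * ((1296 * 16 ^ r) ^ (2 * q) * y ^ q) * R.card := by
        gcongr
        · have : (1 : ℝ) ≤ 16 ^ r := one_le_pow₀ (by norm_num)
          linarith
        · omega
    _ = 4 * (k : ℝ) ^ 2 * ((1296 * 16 ^ r) ^ 2 * y) ^ q * R.card := by
        rw [pow_mul, ← mul_pow]
    _ ≤ 4 * (k : ℝ) ^ 2 * (1 / 2) ^ q * R.card := by gcongr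
    _ ≤ 1 / k * R.card := by
        gcongr
        have h1 : (32 * (q : ℝ) ^ 3) ≤ 2 ^ q := by
          exact_mod_cast thirtytwo_mul_cube_le_two_pow (q := q) (by omega)
        rw [div_pow, one_pow, mul_one_div, div_le_div_iff₀ (by positivity) hk', one_mul]
        refine le_trans ?_ h1
        calc 4 * (k : ℝ) ^ 2 * k = 4 * (k : ℝ) ^ 3 := by ring
          _ ≤ 4 * (2 * (q : ℝ)) ^ 3 := by gcongr
          _ = _ := by ring

end Estimates

/-! ### Ball growth and the diameter of H -/

section Distances

open Classical Finset

variable {V : Type*} [Fintype V] {H : SimpleGraph V}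

/-- The ball of radius `s` around `v` in the graph metric. -/
noncomputable def graphBall (H : SimpleGraph V) (v : V) (s : ℕ) : Finset V :=
  univ.filter fun w => H.dist v w ≤ s

theorem mem_graphBall {v w : V} {s : ℕ} : w ∈ graphBall H v s ↔ H.dist v w ≤ s := by
  simp [graphBall]

theorem exists_adj_dist_eq {V : Type*} {H : SimpleGraph V} (hH : H.Connected) {v w : V} {s : ℕ}
    (h : H.dist v w = s + 1) : ∃ x, H.Adj x w ∧ H.dist v x = s := by
  obtain ⟨p, hp⟩ := hH.exists_walk_length_eq_dist w v
  rw [SimpleGraph.dist_comm, h] at hp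
  cases p with
  | nil => simp at hp
  | cons hadj q =>
    rename_i x
    refine ⟨x, hadj.symm, ?_⟩
    have h1 : H.dist x v ≤ s := by
      have := SimpleGraph.dist_le q
      simp at hp
      omega
    have h2 := hH.dist_triangle (u := v) (v := x) (w := w)
    have h3 : H.dist x w ≤ 1 := by
      rw [SimpleGraph.dist_eq_one_iff_adj.2 hadj.symm]
    rw [SimpleGraph.dist_comm] at h1
    omega

theorem exists_adj_mem_graphBall (hH : H.Connected) {v w : V} {s : ℕ}
    (hw : w ∈ graphBall H v (s + 1)) :
    w ∈ graphBall H v s ∨ ∃ x ∈ graphBall H v s, H.Adj x w := by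
  rw [mem_graphBall] at hw
  rcases Nat.lt_or_ge s (H.dist v w) with h | h
  · obtain ⟨x, hx, hd⟩ := exists_adj_dist_eq hH (show H.dist v w = s + 1 by omega)
    exact Or.inr ⟨x, mem_graphBall.2 hd.le, hx⟩
  · exact Or.inl (mem_graphBall.2 h)

theorem graphBall_subset_succ (v : V) (s : ℕ) : graphBall H v s ⊆ graphBall H v (s + 1) := by
  intro w
  simp only [mem_graphBall]
  omega

theorem graphBall_mono (v : V) {s t : ℕ} (h : s ≤ t) : graphBall H v s ⊆ graphBall H v t := by
  intro w
  simp only [mem_graphBall]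
  omega

theorem mem_graphBall_succ_of_adj (hH : H.Connected) {v x w : V} {s : ℕ}
    (hx : x ∈ graphBall H v s) (h : H.Adj x w) : w ∈ graphBall H v (s + 1) := by
  rw [mem_graphBall] at hx ⊢
  have h2 := hH.dist_triangle (u := v) (v := x) (w := w)
  have h3 := SimpleGraph.dist_eq_one_iff_adj.2 h
  omega

theorem card_graphBall_le (hH : H.Connected) (h3 : H ∈ graphsWithDegrees fun _ : V => 3) (v : V)
    (s : ℕ) : (graphBall H v s).card ≤ 4 ^ s := by
  induction s with
  | zero =>
    rw [pow_zero, card_le_one]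
    intro a ha b hb
    simp only [mem_graphBall, Nat.le_zero, hH.dist_eq_zero_iff] at ha hb
    rw [← ha, hb]
  | succ s ih =>
    have hsub : graphBall H v (s + 1) ⊆ (graphBall H v s).biUnion fun x => insert x (nbrs H x) := by
      intro w hw
      simp only [mem_biUnion, mem_insert, mem_nbrs]
      rcases exists_adj_mem_graphBall hH hw with h | ⟨x, hx, h⟩
      · exact ⟨w, h, Or.inl rfl⟩
      · exact ⟨x, hx, Or.inr h⟩
    refine (card_le_card hsub).trans ((card_biUnion_le_card_mul _ _ 4 fun x _ => ?_).trans ?_)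
    · refine (card_insert_le _ _).trans ?_
      rw [mem_graphsWithDegrees.1 h3]
    · rw [pow_succ]
      gcongr

/-- The pairs whose images under `π` are at distance at most `r`. -/
noncomputable def nearPairs (H : SimpleGraph V) (r : ℕ) (π : Equiv.Perm V) : Finset (Sym2 V) :=
  univ.filter fun e => ∃ i j, e = s(i, j) ∧ H.dist (π i) (π j) ≤ r

theorem mk_mem_nearPairs {r : ℕ} {π : Equiv.Perm V} {i j : V} :
    s(i, j) ∈ nearPairs H r π ↔ H.dist (π i) (π j) ≤ r := by
  simp only [nearPairs, mem_filter, mem_univ, true_and]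
  constructor
  · rintro ⟨a, b, hab, h⟩
    rcases Sym2.eq_iff.1 hab with ⟨rfl, rfl⟩ | ⟨rfl, rfl⟩
    · exact h
    · rwa [SimpleGraph.dist_comm]
  · exact fun h => ⟨i, j, rfl, h⟩

theorem card_nearPairs_le (hH : H.Connected) (h3 : H ∈ graphsWithDegrees fun _ : V => 3) (r : ℕ)
    (π : Equiv.Perm V) : (nearPairs H r π).card ≤ Fintype.card V * 4 ^ r := by
  have hsub : nearPairs H r π ⊆ univ.biUnion fun x : V =>
      (graphBall H x r).image fun y => s(π.symm x, π.symm y) := by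
    intro e
    induction e with | h i j =>
    intro h
    rw [mk_mem_nearPairs] at h
    simp only [mem_biUnion, mem_univ, true_and, mem_image]
    exact ⟨π i, π j, mem_graphBall.2 h, by simp⟩
  refine (card_le_card hsub).trans (card_biUnion_le_card_mul _ _ _ fun x _ => ?_)
  exact card_image_le.trans (card_graphBall_le hH h3 x r)

/-- Every vertex of the smaller ball has all three of its edges inside the larger one; the rest is
the handshake identity. -/
theorem three_mul_card_graphBall_le (hH : H.Connected)
    (h3 : H ∈ graphsWithDegrees fun _ : V => 3) (v : V) (s : ℕ) :
    3 * (graphBall H v s).card ≤ 2 * (edges H ∩ (graphBall H v (s + 1)).sym2).card := by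
  set T := graphBall H v (s + 1)
  have h1 := sum_card_nbrs (edgesWithin H T)
  have h2 : edges (edgesWithin H T) = edges H ∩ T.sym2 := by
    ext e
    induction e with | h i j =>
    simp [edgesWithin]
  rw [← h2, ← h1]
  calc 3 * (graphBall H v s).card = ∑ x ∈ graphBall H v s, 3 := by simp [mul_comm]
    _ = ∑ x ∈ graphBall H v s, (nbrs (edgesWithin H T) x).card := by
        refine sum_congr rfl fun x hx => ?_
        rw [← mem_graphsWithDegrees.1 h3 x]
        congr 1
        ext w
        simp only [mem_nbrs, edgesWithin]
        exact ⟨fun h => ⟨h, graphBall_subset_succ v s hx, mem_graphBall_succ_of_adj hH hx h⟩,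
          fun h => h.1⟩
    _ ≤ _ := sum_le_univ_sum_of_nonneg fun _ => Nat.zero_le _

/-- A ball that stops growing is closed under adjacency. -/
theorem card_graphBall_ge (hH : H.Connected) (v : V) (s : ℕ) :
    s + 1 ≤ (graphBall H v s).card ∨ graphBall H v s = univ := by
  induction s with
  | zero =>
    left
    exact card_pos.2 ⟨v, by simp [mem_graphBall]⟩
  | succ s ih =>
    rcases ih with ih | ih
    · rcases (graphBall_subset_succ (H := H) v s).eq_or_ssubset with h | h
      · right
        have key : ∀ t, graphBall H v (s + 1 + t) ⊆ graphBall H v (s + 1) := by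
          intro t
          induction t with
          | zero => exact Subset.rfl
          | succ t iht =>
            intro w hw
            rcases exists_adj_mem_graphBall hH (show w ∈ graphBall H v (s + 1 + t + 1) from hw)
              with hw | ⟨x, hx, hxw⟩
            · exact iht hw
            · exact mem_graphBall_succ_of_adj hH (h ▸ iht hx) hxw
        exact eq_univ_of_forall fun w => key (H.dist v w) (mem_graphBall.2 (by omega))
      · left
        have := card_lt_card h
        omega
    · right
      exact univ_subset_iff.1 (ih ▸ graphBall_subset_succ v s)

/-- If the ball stayed small, the first 5r steps would make it large enough for `hd`. After that
3|B_s| ≤ 2e(B_{s+1}) < (12/5)|B_{s+1}| gives growth by 5/4 per step, up to at least 4^(20r) ≥ 2k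
vertices. -/
theorem lt_mul_card_graphBall {k r M : ℕ} (hV : Fintype.card V = 2 * k) (hr : 1 ≤ r)
    (hk : 1 ≤ k) (hkr : 2 * k ≤ 4 ^ (20 * r)) (hM : 1 ≤ M) (hH : H.Connected)
    (h3 : H ∈ graphsWithDegrees fun _ : V => 3)
    (hd : ∀ T : Finset V, 5 * r ≤ T.card → M * T.card ≤ k →
      5 * (edges H ∩ T.sym2).card < 6 * T.card) (v : V) :
    k < M * (graphBall H v (133 * r)).card := by
  by_contra! hcon
  have hsmall : ∀ s ≤ 133 * r, M * (graphBall H v s).card ≤ k := fun s hs =>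
    (Nat.mul_le_mul_left M (card_le_card (graphBall_mono v hs))).trans hcon
  have hge : 5 * r + 1 ≤ (graphBall H v (5 * r)).card := by
    refine (card_graphBall_ge hH v (5 * r)).resolve_right fun h => ?_
    have := hsmall (5 * r) (by omega)
    rw [h, card_univ, hV] at this
    nlinarith
  have hgrow : ∀ j ≤ 128 * r, 5 ^ j ≤ (graphBall H v (5 * r + j)).card * 4 ^ j := by
    intro j
    induction j with
    | zero => intro _; simp only [pow_zero, add_zero, mul_one]; omega
    | succ j ih =>
      intro hj
      have h1 := ih (by omega)
      have h2 := three_mul_card_graphBall_le hH h3 v (5 * r + j)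
      have h4 := hd (graphBall H v (5 * r + j + 1))
        (by
          have := card_le_card (graphBall_mono (H := H) v (show 5 * r ≤ 5 * r + j + 1 by omega))
          omega)
        (hsmall _ (by omega))
      have h5 : 5 * (graphBall H v (5 * r + j)).card ≤ 4 * (graphBall H v (5 * r + j + 1)).card := by
        omega
      calc 5 ^ (j + 1) = 5 * 5 ^ j := by ring
        _ ≤ 5 * ((graphBall H v (5 * r + j)).card * 4 ^ j) := by gcongr
        _ = (5 * (graphBall H v (5 * r + j)).card) * 4 ^ j := by ring
        _ ≤ (4 * (graphBall H v (5 * r + j + 1)).card) * 4 ^ j := by gcongr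
        _ = _ := by rw [← add_assoc]; ring
  have h1 := hgrow (128 * r) le_rfl
  -- (5/4)^128 ≥ 4^20: this fixes 128, and the radius factor 133 = 5 + 128.
  have h2 : (4 ^ (20 * r)) * 4 ^ (128 * r) ≤ 5 ^ (128 * r) := by
    rw [pow_mul, pow_mul, pow_mul 5, ← mul_pow]
    exact Nat.pow_le_pow_left (by norm_num) r
  have h4 : 4 ^ (20 * r) ≤ (graphBall H v (5 * r + 128 * r)).card :=
    Nat.le_of_mul_le_mul_right (h2.trans h1) (by positivity)
  have h5 := hsmall (5 * r + 128 * r) (by omega)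
  nlinarith

theorem exists_graph_dist_eq {V : Type*} {H : SimpleGraph V} (hH : H.Connected) (u : V) :
    ∀ (L : ℕ) (v : V), H.dist u v = L → ∀ l ≤ L, ∃ x, H.dist u x = l := by
  intro L
  induction L with
  | zero => intro v hv l hl; exact ⟨v, by omega⟩
  | succ L ih =>
    intro v hv l hl
    rcases hl.eq_or_lt with rfl | hl
    · exact ⟨v, hv⟩
    · obtain ⟨x, -, hx⟩ := exists_adj_dist_eq hH hv
      exact ih x hx l (by omega)

/-- Otherwise there are 2M vertices whose distances from `u` are the multiples of 2R + 1; their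
balls of radius `R` are disjoint and too large to fit in 2k vertices. -/
theorem dist_le_of_lt_mul_card_graphBall {k R M : ℕ} (hV : Fintype.card V = 2 * k)
    (hM : 1 ≤ M) (hH : H.Connected) (hball : ∀ v, k < M * (graphBall H v R).card) (u v : V) :
    H.dist u v ≤ (2 * R + 1) * (2 * M) := by
  by_contra! hcon
  have hex : ∀ i : Fin (2 * M), ∃ x, H.dist u x = (2 * R + 1) * i := fun i =>
    exists_graph_dist_eq hH u _ v rfl _ (by
      refine le_trans ?_ hcon.le
      exact Nat.mul_le_mul_left _ i.2.le)
  choose x hx using hex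
  have hdisj : ∀ i j : Fin (2 * M), i < j → Disjoint (graphBall H (x i) R) (graphBall H (x j) R) := by
    intro i j hij
    rw [disjoint_left]
    intro w hw hw'
    rw [mem_graphBall] at hw hw'
    rw [SimpleGraph.dist_comm] at hw'
    have h1 := hH.dist_triangle (u := u) (v := x i) (w := x j)
    have h2 := hH.dist_triangle (u := x i) (v := w) (w := x j)
    rw [hx, hx] at h1
    have : ((i : ℕ) + 1) ≤ j := hij
    nlinarith
  have hdisj' : ((univ : Finset (Fin (2 * M))) : Set (Fin (2 * M))).PairwiseDisjoint
      fun i => graphBall H (x i) R := by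
    intro i _ j _ hij
    rcases lt_or_gt_of_ne hij with h | h
    · exact hdisj i j h
    · exact (hdisj j i h).symm
  have hcard := card_le_univ (univ.biUnion fun i => graphBall H (x i) R)
  rw [card_biUnion hdisj', hV] at hcard
  have h1 : ∑ i : Fin (2 * M), (k + 1) ≤ ∑ i, M * (graphBall H (x i) R).card :=
    sum_le_sum fun i _ => hball (x i)
  rw [← mul_sum, sum_const, card_univ, Fintype.card_fin, smul_eq_mul] at h1
  nlinarith

end Distances

/-! ### The inequality for good pairs, and the count of bad pairs -/

section Poincare

open Classical Finset

variable {V : Type*} [Fintype V]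

theorem mul_sq_le_sum_adj {k r : ℕ} (hV : Fintype.card V = 2 * k) {G : SimpleGraph V}
    (hG : G ∈ graphsWithDegrees fun _ : V => 3) (H : SimpleGraph V) (π : Equiv.Perm V)
    (h : (edges G ∩ nearPairs H r π).card < (5 * k + 1) / 2) :
    (k : ℝ) * (r : ℝ) ^ 2 ≤
      ∑ i, ∑ j, if G.Adj i j then (H.dist (π i) (π j) : ℝ) ^ 2 else 0 := by
  set S := nearPairs H r π with hS
  have h1 := sum_card_nbrs G
  simp only [mem_graphsWithDegrees.1 hG, sum_const, smul_eq_mul, card_univ, hV] at h1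
  have h2 := sum_card_nbrs (G.deleteEdges S)
  have h3 : edges (G.deleteEdges S) = edges G \ S := by ext; simp
  have h4 := card_sdiff_add_card_inter (edges G) S
  rw [h3] at h2
  -- At least k/2 of the 3k edges are far, and the degree sum counts each twice.
  have h5 : k ≤ ∑ v, (nbrs (G.deleteEdges S) v).card := by omega
  calc (k : ℝ) * (r : ℝ) ^ 2 ≤ ((∑ v, (nbrs (G.deleteEdges S) v).card : ℕ) : ℝ) * (r : ℝ) ^ 2 := by
        gcongr
    _ = ∑ i, ∑ j, if (G.deleteEdges S).Adj i j then (r : ℝ) ^ 2 else 0 := by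
        push_cast
        rw [sum_mul]
        refine sum_congr rfl fun i _ => ?_
        rw [← sum_filter, sum_const, nsmul_eq_mul, nbrs]
        congr!
    _ ≤ _ := by
        refine sum_le_sum fun i _ => sum_le_sum fun j _ => ?_
        simp only [SimpleGraph.deleteEdges_adj, mem_coe, hS, mk_mem_nearPairs]
        split_ifs with h6 h7 h7
        · gcongr
          exact_mod_cast (not_le.1 h6.2).le
        · exact absurd h6.1 h7
        · positivity
        · exact le_rfl

/-- The Poincaré inequality for every bijection between two graphs on the same vertex set. -/
def BijectivePoincare (K : ℝ) (G H : SimpleGraph V) : Prop :=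
  H.Connected ∧ ∀ π : Equiv.Perm V,
    (1 / (Fintype.card V : ℝ) ^ 2) * ∑ i, ∑ j, (H.dist (π i) (π j) : ℝ) ^ 2 ≤
      K * ((1 / (Fintype.card V : ℝ)) *
        ((1 / 2) * ∑ i, ∑ j, if G.Adj i j then (H.dist (π i) (π j) : ℝ) ^ 2 else 0))

theorem bijectivePoincare_of_dist_le {k r D : ℕ} (hk : 1 ≤ k) (hV : Fintype.card V = 2 * k)
    {G H : SimpleGraph V} (hG : G ∈ graphsWithDegrees fun _ : V => 3) (hH : H.Connected)
    (hD : ∀ u v, H.dist u v ≤ D * r)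
    (h : ∀ π, (edges G ∩ nearPairs H r π).card < (5 * k + 1) / 2) :
    BijectivePoincare (4 * (D : ℝ) ^ 2) G H := by
  refine ⟨hH, fun π => ?_⟩
  have h1 := mul_sq_le_sum_adj hV hG H π (h π)
  have hk' : (0 : ℝ) < k := by exact_mod_cast hk
  have h2 : ∑ i, ∑ j, (H.dist (π i) (π j) : ℝ) ^ 2 ≤ (2 * k) * ((2 * k) * (D * r) ^ 2) := by
    have : ∀ i j, (H.dist (π i) (π j) : ℝ) ^ 2 ≤ (D * r) ^ 2 := by
      intro i j
      gcongr
      exact_mod_cast hD (π i) (π j)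
    refine (sum_le_sum fun i _ => sum_le_sum fun j _ => this i j).trans (le_of_eq ?_)
    simp [hV]
  rw [hV]
  push_cast
  calc (1 / (2 * k : ℝ) ^ 2) * ∑ i, ∑ j, (H.dist (π i) (π j) : ℝ) ^ 2
      ≤ (1 / (2 * k : ℝ) ^ 2) * ((2 * k) * ((2 * k) * (D * r) ^ 2)) := by gcongr
    _ = 4 * (D : ℝ) ^ 2 * (1 / (2 * k) * (1 / 2 * (k * r ^ 2))) := by field_simp; ring
    _ ≤ _ := by gcongr

/-- Count bad pairs by fixing `H`: disconnected `H` and `H` with a dense small set are discarded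
with every `G`, at cost 10/k and 1/k; any other `H` is bad for at most a proportion 1/k of the `G`.
-/
theorem exists_card_not_bijectivePoincare_le : ∃ K : ℝ, 0 < K ∧ ∃ k₀ : ℕ,
    ∀ (V : Type) [Fintype V] (k : ℕ), k₀ ≤ k → Fintype.card V = 2 * k →
      ((((graphsWithDegrees fun _ : V => 3) ×ˢ graphsWithDegrees fun _ : V => 3).filter
        fun p => ¬ BijectivePoincare K p.1 p.2).card : ℝ) ≤
        12 / k * ((graphsWithDegrees fun _ : V => 3).card : ℝ) ^ 2 := by
  obtain ⟨M, hM⟩ : ∃ M, 108 ^ 5 * 3 * 4 ^ 80 ≤ M := ⟨_, le_rfl⟩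
  have hM1 : 1 ≤ M := le_trans (by norm_num) hM
  -- 534 = 2 · 267, from the diameter bound (2 · 133r + 1) · 2M ≤ 267r · 2M.
  refine ⟨4 * ((534 * M : ℕ) : ℝ) ^ 2, by positivity, 8 * (1296 ^ 2 * 3) ^ 2, ?_⟩
  intro V _ k hk hV
  set R := graphsWithDegrees fun _ : V => 3 with hR
  -- This gives 4^(10r) ≤ 2k ≤ 4^(20r): the lower side keeps near pairs few, the upper side makes
  -- the diameter O(r).
  obtain ⟨r, hr⟩ : ∃ r, r = Nat.log (4 ^ 10) (2 * k) := ⟨_, rfl⟩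
  have hr0 : 4 ^ (10 * r) ≤ 2 * k := by
    rw [pow_mul, hr]
    exact Nat.pow_log_le_self _ (by omega)
  have hr1 : 1 ≤ r := by
    rw [hr]
    refine Nat.log_pos (by norm_num) (le_trans ?_ (Nat.mul_le_mul_left 2 hk))
    norm_num
  have hr2 : 2 * k ≤ 4 ^ (20 * r) := by
    have h := Nat.lt_pow_succ_log_self (b := 4 ^ 10) (by norm_num) (2 * k)
    rw [← hr, ← pow_mul] at h
    refine h.le.trans (Nat.pow_le_pow_right (by norm_num) ?_)
    omega
  have hZ : 4 * k ^ 4 ≤ (4 ^ 80) ^ r := by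
    calc 4 * k ^ 4 ≤ (2 * k) ^ 4 := by rw [mul_pow]; gcongr; norm_num
      _ ≤ (4 ^ (20 * r)) ^ 4 := by gcongr
      _ = _ := by rw [← pow_mul, ← pow_mul]; congr 1; ring
  set B₁ := R.filter fun G => ¬ G.Connected
  set B₂ := R.filter fun G => ∃ T : Finset V, 5 * r ≤ T.card ∧
        M * T.card ≤ k ∧ 6 * T.card ≤ 5 * (edges G ∩ T.sym2).card
  have hB₁ : (B₁.card : ℝ) ≤ 10 / k * R.card := card_not_connected_le (by omega) hV
  have hB₂ : (B₂.card : ℝ) ≤ 1 / k * R.card :=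
    card_filter_exists_dense_subset_le (by omega) hV hr1 hZ (by norm_num) hM
  have hH : ∀ H ∈ R,
      ((R.filter fun G => ¬ BijectivePoincare (4 * ((534 * M : ℕ) : ℝ) ^ 2) G H).card : ℝ) ≤
        (if H ∈ B₁ then (R.card : ℝ) else 0) + (if H ∈ B₂ then (R.card : ℝ) else 0) +
          1 / k * R.card := by
    intro H hHR
    have hle : ((R.filter fun G =>
        ¬ BijectivePoincare (4 * ((534 * M : ℕ) : ℝ) ^ 2) G H).card : ℝ) ≤ R.card := by
      exact_mod_cast card_filter_le _ _
    have hpos : 0 ≤ 1 / (k : ℝ) * R.card := by positivity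
    by_cases h1 : H ∈ B₁
    · rw [if_pos h1]
      split_ifs <;> linarith [(Nat.cast_nonneg R.card : (0 : ℝ) ≤ R.card)]
    by_cases h2 : H ∈ B₂
    · rw [if_pos h2]
      split_ifs
      linarith
    rw [if_neg h1, if_neg h2, zero_add, zero_add]
    have hconn : H.Connected := by simpa [B₁, hHR] using h1
    have hd : ∀ T : Finset V, 5 * r ≤ T.card → M * T.card ≤ k →
        5 * (edges H ∩ T.sym2).card < 6 * T.card := by
      intro T hT hTk
      by_contra! h
      exact h2 (mem_filter.2 ⟨hHR, T, hT, hTk, h⟩)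
    have hdist : ∀ u v, H.dist u v ≤ 534 * M * r := by
      intro u v
      refine (dist_le_of_lt_mul_card_graphBall hV hM1 hconn (lt_mul_card_graphBall hV hr1
        (by omega) hr2 hM1 hconn hHR hd) u v).trans ?_
      calc (2 * (133 * r) + 1) * (2 * M) ≤ (267 * r) * (2 * M) := by gcongr; omega
        _ = _ := by ring
    refine le_trans ?_ (card_filter_exists_perm_le hV hr0 hk (nearPairs H r) fun π => ?_)
    · refine Nat.cast_le.2 (card_le_card fun G hG => ?_)
      rw [mem_filter] at hG ⊢
      refine ⟨hG.1, ?_⟩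
      by_contra! h
      exact hG.2 (bijectivePoincare_of_dist_le (by omega) hV hG.1 hconn hdist h)
    · rw [← hV]
      exact card_nearPairs_le hconn hHR r π
  have hcount : ((R ×ˢ R).filter
      fun p => ¬ BijectivePoincare (4 * ((534 * M : ℕ) : ℝ) ^ 2) p.1 p.2).card =
      ∑ H ∈ R, (R.filter fun G => ¬ BijectivePoincare (4 * ((534 * M : ℕ) : ℝ) ^ 2) G H).card := by
    simp only [card_filter]
    rw [sum_product_right]
  rw [hcount, Nat.cast_sum]
  refine (sum_le_sum hH).trans ?_
  rw [sum_add_distrib, sum_add_distrib, sum_ite_mem, sum_ite_mem, sum_const, sum_const, sum_const,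
    inter_eq_right.2 (filter_subset _ _), inter_eq_right.2 (filter_subset _ _), nsmul_eq_mul,
    nsmul_eq_mul, nsmul_eq_mul]
  have hRn : (0 : ℝ) ≤ R.card := Nat.cast_nonneg _
  calc (B₁.card : ℝ) * R.card + B₂.card * R.card + R.card * (1 / k * R.card)
      ≤ (10 / k * R.card) * R.card + (1 / k * R.card) * R.card + R.card * (1 / k * R.card) := by
        gcongr
    _ = _ := by ring

end Poincare

/-! ### From counting to probability, and the limit -/

section Probability

theorem measurableSingletonClass_simpleGraph (V : Type*) [Countable V] :
    MeasurableSingletonClass (SimpleGraph V) := by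
  refine ⟨fun G => ?_⟩
  have h : ({G} : Set (SimpleGraph V)) = ⋂ u, ⋂ v, {H | H.Adj u v ↔ G.Adj u v} := by
    ext H
    simp only [Set.mem_singleton_iff, Set.mem_iInter, Set.mem_ofPred_eq]
    exact ⟨fun h => by simp [h], fun h => by ext u v; exact h u v⟩
  rw [h]
  refine MeasurableSet.iInter fun u => MeasurableSet.iInter fun v => ?_
  have hm : Measurable fun H : SimpleGraph V => H.Adj u v :=
    (SimpleGraph.measurable_iff_adj.1 measurable_id) u v
  by_cases hG : G.Adj u v
  · simpa [hG] using measurableSet_setOfPred.2 hm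
  · simpa [hG] using hm.not

theorem regularGraphs_three (n : ℕ) :
    regularGraphs n 3 = ((graphsWithDegrees fun _ : Fin n => 3 : Finset (SimpleGraph (Fin n))) :
      Set (SimpleGraph (Fin n))) := by
  classical
  ext G
  simp only [regularGraphs, Set.mem_ofPred_eq, SimpleGraph.IsRegularOfDegree, Finset.mem_coe,
    mem_graphsWithDegrees]
  refine forall_congr' fun v => ?_
  rw [← SimpleGraph.card_neighborFinset_eq_degree]
  refine Eq.congr_left (congrArg _ ?_)
  ext w
  simp

/-- If all but a proportion `ε` of the pairs in `F × F` have a property, then so do two independent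
uniform elements of `F` with probability at least `1 - ε`. -/
theorem one_sub_le_prod_uniformOn {Ω : Type*} [Finite Ω] [MeasurableSpace Ω]
    [MeasurableSingletonClass Ω] {F : Finset Ω} (hF : F.Nonempty) (P : Ω × Ω → Prop)
    [DecidablePred P] {ε : ℝ}
    (h : (((F ×ˢ F).filter fun p => ¬ P p).card : ℝ) ≤ ε * (F.card : ℝ) ^ 2) :
    1 - ENNReal.ofReal ε ≤
      ((uniformOn (F : Set Ω)).prod (uniformOn (F : Set Ω))) {p | P p} := by
  classical
  have hμ : IsProbabilityMeasure (uniformOn (F : Set Ω)) :=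
    isProbabilityMeasure_uniformOn F.finite_toSet hF
  set μ := uniformOn (F : Set Ω) with hμdef
  have hc : ∀ a ∈ F, μ {a} = (F.card : ENNReal)⁻¹ := by
    intro a ha
    rw [hμdef, ← Finset.coe_singleton, uniformOn_apply_finset,
      Finset.inter_singleton_of_mem ha]
    simp
  have hcompl : μ (F : Set Ω)ᶜ = 0 := by
    rw [prob_compl_eq_zero_iff F.measurableSet]
    exact uniformOn_self F.finite_toSet hF
  set B := (F ×ˢ F).filter fun p => ¬ P p with hB
  have hBμ : (μ.prod μ) (B : Set (Ω × Ω)) ≤ ENNReal.ofReal ε := by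
    have h1 : (μ.prod μ) (B : Set (Ω × Ω)) = ∑ p ∈ B, (μ.prod μ) {p} := by
      rw [sum_measure_singleton]
    have h2 : ∀ p ∈ B, (μ.prod μ) {p} = (F.card : ENNReal)⁻¹ * (F.card : ENNReal)⁻¹ := by
      rintro ⟨a, b⟩ hp
      simp only [hB, Finset.mem_filter, Finset.mem_product] at hp
      rw [← Set.singleton_prod_singleton, Measure.prod_prod, hc a hp.1.1, hc b hp.1.2]
    rw [h1, Finset.sum_congr rfl h2, Finset.sum_const, nsmul_eq_mul]
    have hF0 : (0 : ℝ) < F.card := by exact_mod_cast Finset.card_pos.2 hF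
    have h3 : (B.card : ENNReal) * ((F.card : ENNReal)⁻¹ * (F.card : ENNReal)⁻¹) =
        ENNReal.ofReal ((B.card : ℝ) * ((F.card : ℝ)⁻¹ * (F.card : ℝ)⁻¹)) := by
      rw [ENNReal.ofReal_mul (by positivity), ENNReal.ofReal_mul (by positivity),
        ENNReal.ofReal_inv_of_pos hF0, ENNReal.ofReal_natCast, ENNReal.ofReal_natCast]
    rw [h3]
    refine ENNReal.ofReal_le_ofReal ?_
    calc _ ≤ (ε * (F.card : ℝ) ^ 2) * ((F.card : ℝ)⁻¹ * (F.card : ℝ)⁻¹) := by gcongr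
      _ = ε := by field_simp
  have hbad : (μ.prod μ) {p | P p}ᶜ ≤ ENNReal.ofReal ε := by
    have hsub : {p | P p}ᶜ ⊆ (B : Set (Ω × Ω)) ∪
        (((F : Set Ω)ᶜ ×ˢ Set.univ) ∪ (Set.univ ×ˢ (F : Set Ω)ᶜ)) := by
      rintro ⟨a, b⟩ hp
      by_cases ha : a ∈ F <;> by_cases hb : b ∈ F <;>
        simp_all
    calc _ ≤ (μ.prod μ) (B : Set (Ω × Ω)) + ((μ.prod μ) ((F : Set Ω)ᶜ ×ˢ Set.univ) +
          (μ.prod μ) (Set.univ ×ˢ (F : Set Ω)ᶜ)) :=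
          (measure_mono hsub).trans ((measure_union_le _ _).trans
            (add_le_add_right (measure_union_le _ _) _))
      _ = (μ.prod μ) (B : Set (Ω × Ω)) := by
          rw [Measure.prod_prod, Measure.prod_prod, hcompl]
          simp
      _ ≤ _ := hBμ
  have hmeas : MeasurableSet {p | P p} := (Set.toFinite _).measurableSet
  have hone := prob_add_prob_compl (μ := μ.prod μ) hmeas
  rw [tsub_le_iff_right, ← hone]
  gcongr

end Probability

theorem proposition7p1 :
    ∃ K : ℝ, 0 < K ∧
      Tendsto
        (fun n : ℕ =>
          ((uniformRegularGraph n 3).prod (uniformRegularGraph n 3))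
            {p : SimpleGraph (Fin n) × SimpleGraph (Fin n) | PermutationPoincare K p.1 p.2})
        (atTop ⊓ 𝓟 {n : ℕ | Even n}) (𝓝 1) := by
  classical
  obtain ⟨K, hK, k₀, h⟩ := exists_card_not_bijectivePoincare_le
  refine ⟨K, hK, ?_⟩
  have hlim : Tendsto (fun n : ℕ => 1 - ENNReal.ofReal (12 / ((n / 2 : ℕ) : ℝ))) atTop (𝓝 1) := by
    have h1 : Tendsto (fun n : ℕ => 12 / ((n / 2 : ℕ) : ℝ)) atTop (𝓝 0) :=
      (tendsto_const_div_atTop_nhds_zero_nat 12).comp (Nat.tendsto_div_const_atTop (by norm_num))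
    have h2 := ENNReal.tendsto_ofReal h1
    rw [ENNReal.ofReal_zero] at h2
    simpa using ENNReal.Tendsto.sub tendsto_const_nhds h2 (Or.inl ENNReal.one_ne_top)
  refine tendsto_of_tendsto_of_tendsto_of_le_of_le' (hlim.mono_left inf_le_left)
    tendsto_const_nhds ?_ ?_
  · rw [eventually_inf_principal]
    filter_upwards [eventually_ge_atTop (2 * k₀ + 4)] with n hn heven
    obtain ⟨k, rfl⟩ : ∃ k, n = 2 * k := heven.exists_two_nsmul n |>.imp fun k hk => by simpa using hk
    have := measurableSingletonClass_simpleGraph (Fin (2 * k))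
    -- Existence of cubic graphs comes from the positive lower bound on their number.
    have hne : (graphsWithDegrees fun _ : Fin (2 * k) => 3).Nonempty := by
      rw [← Finset.card_pos, ← cubicCount_univ]
      have h1 := oddProd_le_cubicCount_mul (c := k) (by omega)
        (Finset.univ : Finset (Fin (2 * k))) (by simp)
      exact Nat.pos_of_mul_pos_right ((oddProd_pos _).trans_le h1)
    have h1 := h (Fin (2 * k)) k (by omega) (by simp)
    have h2 : ∀ G H : SimpleGraph (Fin (2 * k)), PermutationPoincare K G H ↔ BijectivePoincare K G H := by
      intro G H
      simp only [PermutationPoincare, BijectivePoincare, edgeSum, Fintype.card_fin]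
    rw [uniformRegularGraph, regularGraphs_three, Nat.mul_div_cancel_left k (by norm_num)]
    simp only [h2]
    refine one_sub_le_prod_uniformOn hne (fun p => BijectivePoincare K p.1 p.2) ?_
    convert h1
  -- No existence is needed here: `uniformOn` of an empty set is the zero measure, so the mass is at
  -- most 1 in every case.
  · refine Eventually.of_forall fun n => ?_
    refine (measure_mono (Set.subset_univ _)).trans ?_
    rw [← Set.univ_prod_univ, uniformRegularGraph, Measure.prod_prod]
    exact mul_le_one' prob_le_one prob_le_one
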